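/- A double signature $\Sigma=(\mathcal O,\mathcal H,\mathcal V,\mathcal D)$ consists of a set $\mathcal O$ of objects, two graphs on $\mathcal O$ with edge sets $\mathcal H(X;Y)$ (horizontal) and $\mathcal V(X;Y)$ (vertical), and, for all $X,Y,Z,W\in\mathcal O$ and all paths $\mathbf u\in\mathrm{path}(\mathcal V)(X;Y)$, $\mathbf h\in\mathrm{path}(\mathcal H)(Y;W)$, $\mathbf k\in\mathrm{path}(\mathcal H)(X;Z)$, $\mathbf v\in\mathrm{path}(\mathcal V)(Z;W)$, a set $\mathcal D(\mathbf u;\mathbf h;\mathbf k;\mathbf v)$ of cells. A morphism is a function on objects, two graph homomorphisms over it, and functions on cells compatible with the boundaries; this gives the category $\mathbf{doubleSig}$. Let $\mathbf{doubleCat}$ be the category of strict double categories and strict double functors, and let $\mathrm{forget}:\mathbf{doubleCat}\to\mathbf{doubleSig}$ send $\mathbb D$ to the double signature with the same objects and arrows, whose cells over a quadruple of paths are the cells of $\mathbb D$ over the composites of these paths. The tilted 2-graph $\mathrm{tilt}(\Sigma)$ has objects $\mathcal O$, arrows $\mathcal V(X;Y)+\mathcal H(X;Y)$, and as 2-arrows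 from the path $\mathbf u,\mathbf h$ to the path $\mathbf k,\mathbf v$ the cells $\mathcal D(\mathbf u;\mathbf h;\mathbf k;\mathbf v)$, with no other 2-arrows. Let $\mathrm{string}(\mathrm{tilt}(\Sigma))$ be the free strict 2-category on it: its 1-cells are the paths, and its 2-cells (string diagrams) are the formal composites of the generating 2-arrows modulo the axioms of strict 2-categories. Let $\mathrm{pinwheel}(\Sigma)$ be the strict double category with objects $\mathcal O$, horizontal arrows $\mathrm{path}(\mathcal H)$, vertical arrows $\mathrm{path}(\mathcal V)$, and as cells with boundary $(\mathbf u;\mathbf h;\mathbf k;\mathbf v)$ the string diagrams $\mathrm{string}(\mathrm{tilt}(\Sigma))(\mathbf u\otimes\mathbf h;\mathbf k\otimes\mathbf v)$. The horizontal composite of $\alpha\in(\mathbf u;\mathbf h;\mathbf k;\mathbf v)$ and $\beta\in(\mathbf v;\mathbf h';\mathbf k';\mathbf w)$ is $\mathbf u\mathbf h\mathbf h'\xrightarrow{\alpha\otimes\mathbf h'}\mathbf k\mathbf v\mathbf h'\xrightarrow{\mathbf k\otimes\beta}\mathbf k\mathbf k'\mathbf w$, and the vertical composite of $\alpha\in(\mathbf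 u;\mathbf h;\mathbf k;\mathbf v)$ and $\gamma\in(\mathbf u';\mathbf i;\mathbf h;\mathbf v')$ is $\mathbf u\mathbf u'\mathbf i\xrightarrow{\mathbf u\otimes\gamma}\mathbf u\mathbf h\mathbf v'\xrightarrow{\alpha\otimes\mathbf v'}\mathbf k\mathbf v\mathbf v'$; identity cells are identity diagrams. Relabelling of generators makes $\mathrm{pinwheel}$ a functor $\mathbf{doubleSig}\to\mathbf{doubleCat}$. **Proposition 16 (Pinwheel monad).** The endofunctor $\mathrm{Pinwheel}=\mathrm{forget}\circ\mathrm{pinwheel}:\mathbf{doubleSig}\to\mathbf{doubleSig}$ is the underlying functor of a monad. Its unit $\Sigma\to\mathrm{Pinwheel}(\Sigma)$ is the inclusion of generators: an edge goes to the path of length one on it, and a cell to the string diagram consisting of that cell. Its multiplication $\mathrm{Pinwheel}(\mathrm{Pinwheel}(\Sigma))\to\mathrm{Pinwheel}(\Sigma)$ is flattening: a path of paths goes to its concatenation, and a string diagram whose generators are labelled by string diagrams goes to the string diagram obtained by substituting these. -/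

import Mathlib

open CategoryTheory

universe u

namespace PinwheelDouble

/-! ## Graphs and paths -/

/-- The vertex type `O`, made into a quiver by the family of edge sets `E`. A type synonym is
needed because the same objects carry several graphs. -/
def Gr {O : Type u} (_E : O → O → Type u) : Type u := O

instance {O : Type u} (E : O → O → Type u) : Quiver.{u} (Gr E) := ⟨E⟩

/-- Paths from `a` to `b` in the graph with edge sets `E`. -/
abbrev GPath {O : Type u} (E : O → O → Type u) (a b : O) : Type u :=
  @Quiver.Path (Gr E) _ a b

section paths

variable {O O' O'' : Type u} {E : O → O → Type u} {E' : O' → O' → Type u}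
  {E'' : O'' → O'' → Type u}

/-- The path of length one on an edge. -/
def single {a b : O} (e : E a b) : GPath E a b := Quiver.Path.cons Quiver.Path.nil e

/-- The action on paths of a graph homomorphism. -/
def mapPath (f : O → O') (g : ∀ a b, E a b → E' (f a) (f b)) {a b : O} (p : GPath E a b) :
    GPath E' (f a) (f b) :=
  Prefunctor.mapPath (V := Gr E) (W := Gr E') { obj := f, map := fun {a b} e => g a b e } p

/-- The action on paths of a map sending each edge to a path: the images are concatenated. -/
def bindPath (f : O → O') (g : ∀ a b, E a b → GPath E' (f a) (f b)) {a : O} :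
    ∀ {b : O}, GPath E a b → GPath E' (f a) (f b)
  | _, Quiver.Path.nil => Quiver.Path.nil
  | _, Quiver.Path.cons p e => (bindPath f g p).comp (g _ _ e)

/-- The composite of a path of arrows of a category. -/
def composePath (C : Category.{u} O) {a : O} : ∀ {b : O}, GPath C.Hom a b → C.Hom a b
  | _, Quiver.Path.nil => C.id a
  | _, Quiver.Path.cons p e => C.comp (composePath C p) e

/-- The category of paths in a graph. -/
@[reducible] def pathCat (E : O → O → Type u) : Category.{u} O where
  Hom a b := GPath E a b
  id _ := Quiver.Path.nil
  comp p q := Quiver.Path.comp p q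
  id_comp p := Quiver.Path.nil_comp p
  comp_id p := Quiver.Path.comp_nil p
  assoc p q r := Quiver.Path.comp_assoc p q r

theorem mapPath_append (f : O → O') (g : ∀ a b, E a b → E' (f a) (f b)) {a b c : O}
    (p : GPath E a b) (q : GPath E b c) :
    mapPath f g (p.comp q) = (mapPath f g p).comp (mapPath f g q) :=
  Prefunctor.mapPath_comp _ p q

theorem mapPath_id {a b : O} (p : GPath E a b) : mapPath (fun x => x) (fun _ _ e => e) p = p :=
  Prefunctor.mapPath_id p

theorem mapPath_mapPath (f : O → O') (g : ∀ a b, E a b → E' (f a) (f b))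
    (f' : O' → O'') (g' : ∀ a b, E' a b → E'' (f' a) (f' b)) {a b : O} (p : GPath E a b) :
    mapPath f' g' (mapPath f g p)
      = mapPath (fun x => f' (f x)) (fun a b e => g' _ _ (g a b e)) p := by
  induction p with
  | nil => rfl
  | cons p e ih => exact congrArg (fun r => Quiver.Path.cons r _) ih

theorem bindPath_append (f : O → O') (g : ∀ a b, E a b → GPath E' (f a) (f b)) {a b c : O}
    (p : GPath E a b) (q : GPath E b c) :
    bindPath f g (p.comp q) = (bindPath f g p).comp (bindPath f g q) := by
  induction q with
  | nil => rfl
  | cons q e ih =>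
    exact (congrArg (fun r => Quiver.Path.comp r (g _ _ e)) ih).trans
      (Quiver.Path.comp_assoc _ _ _)

theorem composePath_mapPath (C : Category.{u} O) (D : Category.{u} O') (f : O → O')
    (g : ∀ a b, C.Hom a b → D.Hom (f a) (f b)) (hid : ∀ a, g a a (C.id a) = D.id (f a))
    (hcomp : ∀ a b c (p : C.Hom a b) (q : C.Hom b c),
      g a c (C.comp p q) = D.comp (g a b p) (g b c q))
    {a b : O} (p : GPath C.Hom a b) :
    composePath D (mapPath f g p) = g a b (composePath C p) := by
  induction p with
  | nil => exact (hid _).symm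
  | cons p e ih =>
    exact (congrArg (fun r => D.comp r (g _ _ e)) ih).trans (hcomp _ _ _ _ _).symm

theorem composePath_single {a b : O} (p : GPath E a b) :
    composePath (pathCat E) (mapPath (fun x => x) (fun _ _ e => single e) p) = p := by
  induction p with
  | nil => rfl
  | cons p e ih => exact congrArg (fun r => Quiver.Path.cons (V := Gr E) r e) ih

theorem composePath_append (C : Category.{u} O) {a b c : O} (p : GPath C.Hom a b)
    (q : GPath C.Hom b c) :
    composePath C (p.comp q) = C.comp (composePath C p) (composePath C q) := by
  induction q with
  | nil => exact (C.comp_id _).symm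
  | cons q e ih => exact (congrArg (fun r => C.comp r e) ih).trans (C.assoc _ _ _)

end paths

/-! ## Double signatures -/

/-- A double signature: objects, horizontal and vertical graphs on them, and a set of cells
`Cell u h k v` for each quadruple of paths `u : X → Y` (vertical), `h : Y → W` (horizontal),
`k : X → Z` (horizontal) and `v : Z → W` (vertical). -/
structure DoubleSig : Type (u + 1) where
  Obj : Type u
  H : Obj → Obj → Type u
  V : Obj → Obj → Type u
  Cell : ∀ {X Y Z W : Obj}, GPath V X Y → GPath H Y W → GPath H X Z → GPath V Z W → Type u

namespace DoubleSig

/-- Transport of a cell along equalities of its boundary paths. -/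
def castCell (S : DoubleSig.{u}) {X Y Z W : S.Obj} {u u' : GPath S.V X Y} {h h' : GPath S.H Y W}
    {k k' : GPath S.H X Z} {v v' : GPath S.V Z W} (hu : u = u') (hh : h = h') (hk : k = k')
    (hv : v = v') (d : S.Cell u h k v) : S.Cell u' h' k' v' :=
  cast (by rw [hu, hh, hk, hv]) d

theorem castCell_heq (S : DoubleSig.{u}) {X Y Z W : S.Obj} {u u' : GPath S.V X Y}
    {h h' : GPath S.H Y W} {k k' : GPath S.H X Z} {v v' : GPath S.V Z W} (hu : u = u')
    (hh : h = h') (hk : k = k') (hv : v = v') (d : S.Cell u h k v) :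
    HEq (S.castCell hu hh hk hv d) d := cast_heq _ _

/-- Morphisms of double signatures. -/
structure Hom (S T : DoubleSig.{u}) : Type u where
  obj : S.Obj → T.Obj
  hor : ∀ X Y, S.H X Y → T.H (obj X) (obj Y)
  ver : ∀ X Y, S.V X Y → T.V (obj X) (obj Y)
  cell : ∀ {X Y Z W : S.Obj} (u : GPath S.V X Y) (h : GPath S.H Y W) (k : GPath S.H X Z)
    (v : GPath S.V Z W), S.Cell u h k v →
      T.Cell (mapPath obj ver u) (mapPath obj hor h) (mapPath obj hor k) (mapPath obj ver v)

theorem Hom.cell_heq {S T : DoubleSig.{u}} (f : Hom S T) {X Y Z W : S.Obj}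
    {u u' : GPath S.V X Y} {h h' : GPath S.H Y W} {k k' : GPath S.H X Z} {v v' : GPath S.V Z W}
    (hu : u = u') (hh : h = h') (hk : k = k') (hv : v = v') {d : S.Cell u h k v}
    {d' : S.Cell u' h' k' v'} (hd : HEq d d') : HEq (f.cell u h k v d) (f.cell u' h' k' v' d') := by
  subst hu hh hk hv
  rw [eq_of_heq hd]

/-- Morphisms that agree on objects and edges are equal as soon as they agree on cells. -/
theorem Hom.ext_cell {S T : DoubleSig.{u}} {o : S.Obj → T.Obj}
    {hor hor' : ∀ X Y, S.H X Y → T.H (o X) (o Y)} {ver ver' : ∀ X Y, S.V X Y → T.V (o X) (o Y)}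
    {c : ∀ {X Y Z W : S.Obj} (u : GPath S.V X Y) (h : GPath S.H Y W) (k : GPath S.H X Z)
      (v : GPath S.V Z W), S.Cell u h k v →
        T.Cell (mapPath o ver u) (mapPath o hor h) (mapPath o hor k) (mapPath o ver v)}
    {c' : ∀ {X Y Z W : S.Obj} (u : GPath S.V X Y) (h : GPath S.H Y W) (k : GPath S.H X Z)
      (v : GPath S.V Z W), S.Cell u h k v →
        T.Cell (mapPath o ver' u) (mapPath o hor' h) (mapPath o hor' k) (mapPath o ver' v)}
    (hh : ∀ X Y e, hor X Y e = hor' X Y e) (hv : ∀ X Y e, ver X Y e = ver' X Y e)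
    (hc : ∀ {X Y Z W : S.Obj} (u : GPath S.V X Y) (h : GPath S.H Y W) (k : GPath S.H X Z)
      (v : GPath S.V Z W) (d : S.Cell u h k v), HEq (c u h k v d) (c' u h k v d)) :
    (⟨o, hor, ver, c⟩ : Hom S T) = ⟨o, hor', ver', c'⟩ := by
  obtain rfl : hor = hor' := by funext X Y e; exact hh X Y e
  obtain rfl : ver = ver' := by funext X Y e; exact hv X Y e
  have : @c = @c' := by
    funext X Y Z W u h k v d
    exact eq_of_heq (hc u h k v d)
  subst this
  rfl

/-- The identity morphism. -/
def Hom.id (S : DoubleSig.{u}) : Hom S S where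
  obj X := X
  hor _ _ e := e
  ver _ _ e := e
  cell u h k v d := S.castCell (mapPath_id u).symm (mapPath_id h).symm (mapPath_id k).symm
    (mapPath_id v).symm d

/-- Composition of morphisms. -/
def Hom.comp {S T R : DoubleSig.{u}} (f : Hom S T) (g : Hom T R) : Hom S R where
  obj X := g.obj (f.obj X)
  hor _ _ e := g.hor _ _ (f.hor _ _ e)
  ver _ _ e := g.ver _ _ (f.ver _ _ e)
  cell u h k v d := R.castCell (mapPath_mapPath _ _ _ _ u) (mapPath_mapPath _ _ _ _ h)
    (mapPath_mapPath _ _ _ _ k) (mapPath_mapPath _ _ _ _ v) (g.cell _ _ _ _ (f.cell u h k v d))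

/-- The category of double signatures. -/
instance : Category.{u} DoubleSig.{u} where
  Hom := Hom
  id := Hom.id
  comp := Hom.comp
  id_comp f := by
    refine Hom.ext_cell (fun _ _ _ => rfl) (fun _ _ _ => rfl) (fun u h k v d => ?_)
    refine (cast_heq _ _).trans ?_
    exact f.cell_heq (mapPath_id u) (mapPath_id h) (mapPath_id k) (mapPath_id v)
      (cast_heq _ _)
  comp_id f := by
    refine Hom.ext_cell (fun _ _ _ => rfl) (fun _ _ _ => rfl) (fun u h k v d => ?_)
    exact (cast_heq _ _).trans (cast_heq _ _)
  assoc f g j := by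
    refine Hom.ext_cell (fun _ _ _ => rfl) (fun _ _ _ => rfl) (fun u h k v d => ?_)
    refine (cast_heq _ _).trans (HEq.trans ?_ (cast_heq _ _).symm)
    refine HEq.trans ?_ (cast_heq _ _).symm
    exact j.cell_heq (mapPath_mapPath f.obj f.ver g.obj g.ver u).symm
      (mapPath_mapPath f.obj f.hor g.obj g.hor h).symm
      (mapPath_mapPath f.obj f.hor g.obj g.hor k).symm
      (mapPath_mapPath f.obj f.ver g.obj g.ver v).symm (cast_heq _ _)

end DoubleSig

/-! ## Strict double categories -/

/-- A strict double category: objects, a category of horizontal arrows and a category of vertical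
arrows on these objects, and cells
```
      k
  X ----> Z
  |       |
u |       | v
  v       v
  Y ----> W
      h
```
written `Cell u h k v`, with strictly associative and unital horizontal and vertical compositions
that satisfy the interchange law. The laws that hold over an equality of boundaries are stated
as heterogeneous equalities. -/
structure DoubleCat : Type (u + 1) where
  Obj : Type u
  hcat : Category.{u} Obj
  vcat : Category.{u} Obj
  Cell : ∀ {X Y Z W : Obj}, vcat.Hom X Y → hcat.Hom Y W → hcat.Hom X Z → vcat.Hom Z W → Type u
  /-- The horizontal identity cell on a vertical arrow. -/
  idV : ∀ {X Y : Obj} (u : vcat.Hom X Y), Cell u (hcat.id Y) (hcat.id X) u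
  /-- The vertical identity cell on a horizontal arrow. -/
  idH : ∀ {X Y : Obj} (h : hcat.Hom X Y), Cell (vcat.id X) h h (vcat.id Y)
  /-- Horizontal composition. -/
  hcomp : ∀ {X Y Z W P Q : Obj} {u : vcat.Hom X Y} {h : hcat.Hom Y W} {k : hcat.Hom X Z}
    {v : vcat.Hom Z W} {h' : hcat.Hom W Q} {k' : hcat.Hom Z P} {w : vcat.Hom P Q},
    Cell u h k v → Cell v h' k' w → Cell u (hcat.comp h h') (hcat.comp k k') w
  /-- Vertical composition, the first cell being on top of the second one. -/
  vcomp : ∀ {X Y Z W P Q : Obj} {u : vcat.Hom X Y} {h : hcat.Hom Y W} {k : hcat.Hom X Z}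
    {v : vcat.Hom Z W} {u' : vcat.Hom Y P} {i : hcat.Hom P Q} {v' : vcat.Hom W Q},
    Cell u h k v → Cell u' i h v' → Cell (vcat.comp u u') i k (vcat.comp v v')
  hcomp_assoc : ∀ {X Y Z W P Q R S : Obj} {u : vcat.Hom X Y} {h : hcat.Hom Y W}
    {k : hcat.Hom X Z} {v : vcat.Hom Z W} {h' : hcat.Hom W Q} {k' : hcat.Hom Z P}
    {w : vcat.Hom P Q} {h'' : hcat.Hom Q S} {k'' : hcat.Hom P R} {x : vcat.Hom R S}
    (a : Cell u h k v) (b : Cell v h' k' w) (c : Cell w h'' k'' x),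
    HEq (hcomp (hcomp a b) c) (hcomp a (hcomp b c))
  vcomp_assoc : ∀ {X Y Z W P Q R S : Obj} {u : vcat.Hom X Y} {h : hcat.Hom Y W}
    {k : hcat.Hom X Z} {v : vcat.Hom Z W} {u' : vcat.Hom Y P} {i : hcat.Hom P Q}
    {v' : vcat.Hom W Q} {u'' : vcat.Hom P R} {j : hcat.Hom R S} {v'' : vcat.Hom Q S}
    (a : Cell u h k v) (b : Cell u' i h v') (c : Cell u'' j i v''),
    HEq (vcomp (vcomp a b) c) (vcomp a (vcomp b c))
  idV_hcomp : ∀ {X Y Z W : Obj} {u : vcat.Hom X Y} {h : hcat.Hom Y W} {k : hcat.Hom X Z}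
    {v : vcat.Hom Z W} (a : Cell u h k v), HEq (hcomp (idV u) a) a
  hcomp_idV : ∀ {X Y Z W : Obj} {u : vcat.Hom X Y} {h : hcat.Hom Y W} {k : hcat.Hom X Z}
    {v : vcat.Hom Z W} (a : Cell u h k v), HEq (hcomp a (idV v)) a
  idH_vcomp : ∀ {X Y Z W : Obj} {u : vcat.Hom X Y} {h : hcat.Hom Y W} {k : hcat.Hom X Z}
    {v : vcat.Hom Z W} (a : Cell u h k v), HEq (vcomp (idH k) a) a
  vcomp_idH : ∀ {X Y Z W : Obj} {u : vcat.Hom X Y} {h : hcat.Hom Y W} {k : hcat.Hom X Z}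
    {v : vcat.Hom Z W} (a : Cell u h k v), HEq (vcomp a (idH h)) a
  idV_id : ∀ X : Obj, idV (vcat.id X) = idH (hcat.id X)
  idV_comp : ∀ {X Y Z : Obj} (u : vcat.Hom X Y) (v : vcat.Hom Y Z),
    idV (vcat.comp u v) = vcomp (idV u) (idV v)
  idH_comp : ∀ {X Y Z : Obj} (h : hcat.Hom X Y) (k : hcat.Hom Y Z),
    idH (hcat.comp h k) = hcomp (idH h) (idH k)
  interchange : ∀ {X Y Z W P Q R S T : Obj} {u : vcat.Hom X Y} {h : hcat.Hom Y W}
    {k : hcat.Hom X Z} {v : vcat.Hom Z W} {h' : hcat.Hom W Q} {k' : hcat.Hom Z P}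
    {w : vcat.Hom P Q} {u' : vcat.Hom Y R} {i : hcat.Hom R S} {v' : vcat.Hom W S}
    {i' : hcat.Hom S T} {w' : vcat.Hom Q T}
    (a : Cell u h k v) (b : Cell v h' k' w) (c : Cell u' i h v') (d : Cell v' i' h' w'),
    vcomp (hcomp a b) (hcomp c d) = hcomp (vcomp a c) (vcomp b d)

/-- Strict double functors. -/
structure DoubleFunctor (C D : DoubleCat.{u}) : Type u where
  obj : C.Obj → D.Obj
  hor : ∀ X Y, C.hcat.Hom X Y → D.hcat.Hom (obj X) (obj Y)
  ver : ∀ X Y, C.vcat.Hom X Y → D.vcat.Hom (obj X) (obj Y)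
  hor_id : ∀ X, hor X X (C.hcat.id X) = D.hcat.id (obj X)
  hor_comp : ∀ X Y Z (p : C.hcat.Hom X Y) (q : C.hcat.Hom Y Z),
    hor X Z (C.hcat.comp p q) = D.hcat.comp (hor X Y p) (hor Y Z q)
  ver_id : ∀ X, ver X X (C.vcat.id X) = D.vcat.id (obj X)
  ver_comp : ∀ X Y Z (p : C.vcat.Hom X Y) (q : C.vcat.Hom Y Z),
    ver X Z (C.vcat.comp p q) = D.vcat.comp (ver X Y p) (ver Y Z q)
  cell : ∀ {X Y Z W : C.Obj} (u : C.vcat.Hom X Y) (h : C.hcat.Hom Y W) (k : C.hcat.Hom X Z)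
    (v : C.vcat.Hom Z W), C.Cell u h k v → D.Cell (ver _ _ u) (hor _ _ h) (hor _ _ k) (ver _ _ v)
  cell_idV : ∀ {X Y : C.Obj} (u : C.vcat.Hom X Y),
    HEq (cell _ _ _ _ (C.idV u)) (D.idV (ver _ _ u))
  cell_idH : ∀ {X Y : C.Obj} (h : C.hcat.Hom X Y),
    HEq (cell _ _ _ _ (C.idH h)) (D.idH (hor _ _ h))
  cell_hcomp : ∀ {X Y Z W P Q : C.Obj} {u : C.vcat.Hom X Y} {h : C.hcat.Hom Y W}
    {k : C.hcat.Hom X Z} {v : C.vcat.Hom Z W} {h' : C.hcat.Hom W Q} {k' : C.hcat.Hom Z P}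
    {w : C.vcat.Hom P Q} (a : C.Cell u h k v) (b : C.Cell v h' k' w),
    HEq (cell _ _ _ _ (C.hcomp a b)) (D.hcomp (cell _ _ _ _ a) (cell _ _ _ _ b))
  cell_vcomp : ∀ {X Y Z W P Q : C.Obj} {u : C.vcat.Hom X Y} {h : C.hcat.Hom Y W}
    {k : C.hcat.Hom X Z} {v : C.vcat.Hom Z W} {u' : C.vcat.Hom Y P} {i : C.hcat.Hom P Q}
    {v' : C.vcat.Hom W Q} (a : C.Cell u h k v) (b : C.Cell u' i h v'),
    HEq (cell _ _ _ _ (C.vcomp a b)) (D.vcomp (cell _ _ _ _ a) (cell _ _ _ _ b))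

namespace DoubleFunctor

theorem cell_heq {C D : DoubleCat.{u}} (F : DoubleFunctor C D) {X Y Z W : C.Obj}
    {u u' : C.vcat.Hom X Y} {h h' : C.hcat.Hom Y W} {k k' : C.hcat.Hom X Z}
    {v v' : C.vcat.Hom Z W} (hu : u = u') (hh : h = h') (hk : k = k') (hv : v = v')
    {d : C.Cell u h k v} {d' : C.Cell u' h' k' v'} (hd : HEq d d') :
    HEq (F.cell u h k v d) (F.cell u' h' k' v' d') := by
  subst hu hh hk hv
  rw [eq_of_heq hd]

/-- Double functors that agree on objects, arrows and cells are equal. -/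
theorem ext_cell {C D : DoubleCat.{u}} {F G : DoubleFunctor C D} (ho : F.obj = G.obj)
    (hh : ∀ X Y e, HEq (F.hor X Y e) (G.hor X Y e)) (hv : ∀ X Y e, HEq (F.ver X Y e) (G.ver X Y e))
    (hc : ∀ {X Y Z W : C.Obj} (u : C.vcat.Hom X Y) (h : C.hcat.Hom Y W) (k : C.hcat.Hom X Z)
      (v : C.vcat.Hom Z W) (d : C.Cell u h k v), HEq (F.cell u h k v d) (G.cell u h k v d)) :
    F = G := by
  obtain ⟨o, hor, ver, _, _, _, _, c, _, _, _, _⟩ := F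
  obtain ⟨o', hor', ver', _, _, _, _, c', _, _, _, _⟩ := G
  dsimp only at ho hh hv hc
  subst ho
  obtain rfl : hor = hor' := by funext X Y e; exact eq_of_heq (hh X Y e)
  obtain rfl : ver = ver' := by funext X Y e; exact eq_of_heq (hv X Y e)
  have : @c = @c' := by
    funext X Y Z W u h k v d
    exact eq_of_heq (hc u h k v d)
  subst this
  rfl

/-- The identity double functor. -/
def id (C : DoubleCat.{u}) : DoubleFunctor C C where
  obj X := X
  hor _ _ e := e
  ver _ _ e := e
  hor_id _ := rfl
  hor_comp _ _ _ _ _ := rfl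
  ver_id _ := rfl
  ver_comp _ _ _ _ _ := rfl
  cell _ _ _ _ d := d
  cell_idV _ := HEq.rfl
  cell_idH _ := HEq.rfl
  cell_hcomp _ _ := HEq.rfl
  cell_vcomp _ _ := HEq.rfl

/-- Composition of double functors. -/
def comp {C D E : DoubleCat.{u}} (F : DoubleFunctor C D) (G : DoubleFunctor D E) :
    DoubleFunctor C E where
  obj X := G.obj (F.obj X)
  hor _ _ e := G.hor _ _ (F.hor _ _ e)
  ver _ _ e := G.ver _ _ (F.ver _ _ e)
  hor_id X := by rw [F.hor_id, G.hor_id]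
  hor_comp _ _ _ p q := by rw [F.hor_comp, G.hor_comp]
  ver_id X := by rw [F.ver_id, G.ver_id]
  ver_comp _ _ _ p q := by rw [F.ver_comp, G.ver_comp]
  cell _ _ _ _ d := G.cell _ _ _ _ (F.cell _ _ _ _ d)
  cell_idV u := (G.cell_heq rfl (F.hor_id _) (F.hor_id _) rfl (F.cell_idV u)).trans (G.cell_idV _)
  cell_idH h := (G.cell_heq (F.ver_id _) rfl rfl (F.ver_id _) (F.cell_idH h)).trans (G.cell_idH _)
  cell_hcomp a b := (G.cell_heq rfl (F.hor_comp _ _ _ _ _) (F.hor_comp _ _ _ _ _) rfl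
    (F.cell_hcomp a b)).trans (G.cell_hcomp _ _)
  cell_vcomp a b := (G.cell_heq (F.ver_comp _ _ _ _ _) rfl rfl (F.ver_comp _ _ _ _ _)
    (F.cell_vcomp a b)).trans (G.cell_vcomp _ _)

end DoubleFunctor

/-- The category of strict double categories and strict double functors. -/
instance : Category.{u} DoubleCat.{u} where
  Hom := DoubleFunctor
  id := DoubleFunctor.id
  comp := DoubleFunctor.comp

/-! ## The forgetful functor -/

/-- The underlying double signature of a double category: its cells over a quadruple of paths are
the cells over the composites of these paths. -/
def forgetObj (D : DoubleCat.{u}) : DoubleSig.{u} where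
  Obj := D.Obj
  H := D.hcat.Hom
  V := D.vcat.Hom
  Cell u h k v := D.Cell (composePath D.vcat u) (composePath D.hcat h) (composePath D.hcat k)
    (composePath D.vcat v)

/-- Transport of a cell of a double category along equalities of its boundary arrows. -/
def DoubleCat.castCell (D : DoubleCat.{u}) {X Y Z W : D.Obj} {u u' : D.vcat.Hom X Y}
    {h h' : D.hcat.Hom Y W} {k k' : D.hcat.Hom X Z} {v v' : D.vcat.Hom Z W} (hu : u = u')
    (hh : h = h') (hk : k = k') (hv : v = v') (d : D.Cell u h k v) : D.Cell u' h' k' v' :=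
  cast (by rw [hu, hh, hk, hv]) d

theorem DoubleCat.castCell_heq (D : DoubleCat.{u}) {X Y Z W : D.Obj} {u u' : D.vcat.Hom X Y}
    {h h' : D.hcat.Hom Y W} {k k' : D.hcat.Hom X Z} {v v' : D.vcat.Hom Z W} (hu : u = u')
    (hh : h = h') (hk : k = k') (hv : v = v') (d : D.Cell u h k v) :
    HEq (D.castCell hu hh hk hv d) d := cast_heq _ _

/-- The underlying morphism of double signatures of a double functor. -/
def forgetMap {C D : DoubleCat.{u}} (F : DoubleFunctor C D) :
    DoubleSig.Hom (forgetObj C) (forgetObj D) where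
  obj := F.obj
  hor := F.hor
  ver := F.ver
  cell u h k v d := D.castCell
    (composePath_mapPath C.vcat D.vcat F.obj F.ver F.ver_id F.ver_comp u).symm
    (composePath_mapPath C.hcat D.hcat F.obj F.hor F.hor_id F.hor_comp h).symm
    (composePath_mapPath C.hcat D.hcat F.obj F.hor F.hor_id F.hor_comp k).symm
    (composePath_mapPath C.vcat D.vcat F.obj F.ver F.ver_id F.ver_comp v).symm
    (F.cell _ _ _ _ d)

/-- The forgetful functor from double categories to double signatures. -/
def forget : DoubleCat.{u} ⥤ DoubleSig.{u} where
  obj := forgetObj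
  map F := forgetMap F
  map_id C := by
    refine DoubleSig.Hom.ext_cell (fun _ _ _ => rfl) (fun _ _ _ => rfl) (fun u h k v d => ?_)
    exact (cast_heq _ _).trans
      (cast_heq _ _).symm
  map_comp {C D E} F G := by
    refine DoubleSig.Hom.ext_cell (fun _ _ _ => rfl) (fun _ _ _ => rfl) (fun u h k v d => ?_)
    refine (cast_heq _ _).trans
      (HEq.trans ?_ (cast_heq _ _).symm)
    refine HEq.trans ?_ (cast_heq _ _).symm
    exact G.cell_heq
      (composePath_mapPath C.vcat D.vcat F.obj F.ver F.ver_id F.ver_comp u).symm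
      (composePath_mapPath C.hcat D.hcat F.obj F.hor F.hor_id F.hor_comp h).symm
      (composePath_mapPath C.hcat D.hcat F.obj F.hor F.hor_id F.hor_comp k).symm
      (composePath_mapPath C.vcat D.vcat F.obj F.ver F.ver_id F.ver_comp v).symm
      (cast_heq _ _).symm

/-! ## 2-graphs and the free strict 2-category -/

/-- A 2-graph: objects, arrows between objects, 2-arrows between parallel paths of arrows. -/
structure TwoGraph : Type (u + 1) where
  Obj : Type u
  Arr : Obj → Obj → Type u
  Cell : ∀ {a b : Obj}, GPath Arr a b → GPath Arr a b → Type u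

namespace TwoGraph

/-- Formal composites of generating 2-cells: the expressions that denote 2-cells of the free
strict 2-category on `G`, whose 1-cells are the paths of `G`. -/
inductive Expr (G : TwoGraph.{u}) : ∀ {a b : G.Obj}, GPath G.Arr a b → GPath G.Arr a b → Type u
  | gen {a b : G.Obj} {p q : GPath G.Arr a b} (g : G.Cell p q) : Expr G p q
  | id {a b : G.Obj} (p : GPath G.Arr a b) : Expr G p p
  /-- Sequential (vertical) composition. -/
  | seq {a b : G.Obj} {p q r : GPath G.Arr a b} (s : Expr G p q) (t : Expr G q r) : Expr G p r
  /-- Parallel (horizontal) composition. -/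
  | par {a b c : G.Obj} {p q : GPath G.Arr a b} {p' q' : GPath G.Arr b c} (s : Expr G p q)
      (t : Expr G p' q') : Expr G (p.comp p') (q.comp q')

/-- The congruence generated by the axioms of strict 2-categories. Since concatenation of paths is
associative and unital only up to provable equality, the relation is between expressions over
possibly different expressions of the same boundary. -/
inductive Rel (G : TwoGraph.{u}) : ∀ {a b : G.Obj} {p q : GPath G.Arr a b} {a' b' : G.Obj}
    {p' q' : GPath G.Arr a' b'}, Expr G p q → Expr G p' q' → Prop
  | refl {a b : G.Obj} {p q : GPath G.Arr a b} (s : Expr G p q) : Rel G s s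
  | symm {a b : G.Obj} {p q : GPath G.Arr a b} {a' b' : G.Obj} {p' q' : GPath G.Arr a' b'}
      {s : Expr G p q} {t : Expr G p' q'} : Rel G s t → Rel G t s
  | trans {a b : G.Obj} {p q : GPath G.Arr a b} {a' b' : G.Obj} {p' q' : GPath G.Arr a' b'}
      {a'' b'' : G.Obj} {p'' q'' : GPath G.Arr a'' b''} {s : Expr G p q} {t : Expr G p' q'}
      {r : Expr G p'' q''} : Rel G s t → Rel G t r → Rel G s r
  | seq_congr {a b : G.Obj} {p q r : GPath G.Arr a b} {a' b' : G.Obj}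
      {p' q' r' : GPath G.Arr a' b'} {s : Expr G p q} {t : Expr G q r} {s' : Expr G p' q'}
      {t' : Expr G q' r'} : Rel G s s' → Rel G t t' → Rel G (s.seq t) (s'.seq t')
  | par_congr {a b c : G.Obj} {p q : GPath G.Arr a b} {m n : GPath G.Arr b c} {a' b' c' : G.Obj}
      {p' q' : GPath G.Arr a' b'} {m' n' : GPath G.Arr b' c'} {s : Expr G p q} {t : Expr G m n}
      {s' : Expr G p' q'} {t' : Expr G m' n'} :
      Rel G s s' → Rel G t t' → Rel G (s.par t) (s'.par t')
  | id_seq {a b : G.Obj} {p q : GPath G.Arr a b} (s : Expr G p q) : Rel G ((Expr.id p).seq s) s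
  | seq_id {a b : G.Obj} {p q : GPath G.Arr a b} (s : Expr G p q) : Rel G (s.seq (Expr.id q)) s
  | seq_assoc {a b : G.Obj} {p q r m : GPath G.Arr a b} (s : Expr G p q) (t : Expr G q r)
      (w : Expr G r m) : Rel G ((s.seq t).seq w) (s.seq (t.seq w))
  | id_par {a b : G.Obj} {p q : GPath G.Arr a b} (s : Expr G p q) :
      Rel G ((Expr.id (Quiver.Path.nil : GPath G.Arr a a)).par s) s
  | par_id {a b : G.Obj} {p q : GPath G.Arr a b} (s : Expr G p q) :
      Rel G (s.par (Expr.id (Quiver.Path.nil : GPath G.Arr b b))) s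
  | par_assoc {a b c d : G.Obj} {p q : GPath G.Arr a b} {m n : GPath G.Arr b c}
      {k l : GPath G.Arr c d} (s : Expr G p q) (t : Expr G m n) (w : Expr G k l) :
      Rel G ((s.par t).par w) (s.par (t.par w))
  | par_ids {a b c : G.Obj} (p : GPath G.Arr a b) (q : GPath G.Arr b c) :
      Rel G ((Expr.id p).par (Expr.id q)) (Expr.id (p.comp q))
  | interchange {a b c : G.Obj} {p q r : GPath G.Arr a b} {m n l : GPath G.Arr b c}
      (s : Expr G p q) (t : Expr G q r) (s' : Expr G m n) (t' : Expr G n l) :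
      Rel G ((s.seq t).par (s'.seq t')) ((s.par s').seq (t.par t'))

/-- Equality of 2-cells, on expressions with the same boundary. -/
def exprSetoid (G : TwoGraph.{u}) {a b : G.Obj} (p q : GPath G.Arr a b) : Setoid (Expr G p q) where
  r s t := Rel G s t
  iseqv := ⟨Rel.refl, Rel.symm, Rel.trans⟩

/-- String diagrams on the 2-graph `G`: the 2-cells of the free strict 2-category on `G`. -/
def Diagram (G : TwoGraph.{u}) {a b : G.Obj} (p q : GPath G.Arr a b) : Type u :=
  Quotient (exprSetoid G p q)

namespace Diagram

variable {G : TwoGraph.{u}}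

/-- The diagram denoted by an expression. -/
def mk {a b : G.Obj} {p q : GPath G.Arr a b} (s : Expr G p q) : Diagram G p q :=
  Quotient.mk (exprSetoid G p q) s

/-- The generating diagram on a 2-arrow. -/
def gen {a b : G.Obj} {p q : GPath G.Arr a b} (g : G.Cell p q) : Diagram G p q := mk (.gen g)

/-- The identity diagram. -/
def id {a b : G.Obj} (p : GPath G.Arr a b) : Diagram G p p := mk (.id p)

/-- Sequential composition of diagrams. -/
def seq {a b : G.Obj} {p q r : GPath G.Arr a b} (x : Diagram G p q) (y : Diagram G q r) :
    Diagram G p r :=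
  Quotient.liftOn₂ x y (fun s t => mk (s.seq t))
    (fun _ _ _ _ h h' => Quotient.sound (Rel.seq_congr h h'))

/-- Parallel composition of diagrams. -/
def par {a b c : G.Obj} {p q : GPath G.Arr a b} {p' q' : GPath G.Arr b c} (x : Diagram G p q)
    (y : Diagram G p' q') : Diagram G (p.comp p') (q.comp q') :=
  Quotient.liftOn₂ x y (fun s t => mk (s.par t))
    (fun _ _ _ _ h h' => Quotient.sound (Rel.par_congr h h'))

/-- Transport of a diagram along equalities of its boundary paths. -/
def castD {a b : G.Obj} {p q p' q' : GPath G.Arr a b} (hp : p = p') (hq : q = q')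
    (x : Diagram G p q) : Diagram G p' q' :=
  cast (by rw [hp, hq]) x

/-- Equality of diagrams whose boundaries are equal, but maybe not literally the same. -/
inductive SEq : ∀ {a b : G.Obj} {p q : GPath G.Arr a b} {a' b' : G.Obj} {p' q' : GPath G.Arr a' b'},
    Diagram G p q → Diagram G p' q' → Prop
  | refl {a b : G.Obj} {p q : GPath G.Arr a b} (x : Diagram G p q) : SEq x x

section SEq

variable {a b c d a' b' c' a'' b'' : G.Obj}

theorem SEq.symm {p q : GPath G.Arr a b} {p' q' : GPath G.Arr a' b'} {x : Diagram G p q}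
    {y : Diagram G p' q'} (h : SEq x y) : SEq y x := by
  cases h; exact .refl _

theorem SEq.trans {p q : GPath G.Arr a b} {p' q' : GPath G.Arr a' b'} {p'' q'' : GPath G.Arr a'' b''}
    {x : Diagram G p q} {y : Diagram G p' q'} {z : Diagram G p'' q''} (h : SEq x y) (h' : SEq y z) :
    SEq x z := by
  cases h; exact h'

theorem SEq.heq {p q : GPath G.Arr a b} {p' q' : GPath G.Arr a' b'} {x : Diagram G p q}
    {y : Diagram G p' q'} (h : SEq x y) : HEq x y := by
  cases h; rfl

theorem SEq.eq {p q : GPath G.Arr a b} {x y : Diagram G p q} (h : SEq x y) : x = y :=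
  eq_of_heq h.heq

theorem SEq.of_heq {p q p' q' : GPath G.Arr a b} (hp : p = p') (hq : q = q') {x : Diagram G p q}
    {y : Diagram G p' q'} (h : HEq x y) : SEq x y := by
  subst hp hq; cases h; exact .refl _

theorem castD_seq {p q p' q' : GPath G.Arr a b} (hp : p = p') (hq : q = q') (x : Diagram G p q) :
    SEq (castD hp hq x) x := by
  subst hp hq; exact .refl _

theorem SEq.seq {p q r : GPath G.Arr a b} {p' q' r' : GPath G.Arr a' b'} {x : Diagram G p q}
    {y : Diagram G q r} {x' : Diagram G p' q'} {y' : Diagram G q' r'} (h : SEq x x')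
    (h' : SEq y y') : SEq (x.seq y) (x'.seq y') := by
  cases h; cases h'; exact .refl _

theorem SEq.par {p q : GPath G.Arr a b} {m n : GPath G.Arr b c} {p' q' : GPath G.Arr a' b'}
    {m' n' : GPath G.Arr b' c'} {x : Diagram G p q} {y : Diagram G m n} {x' : Diagram G p' q'}
    {y' : Diagram G m' n'} (h : SEq x x') (h' : SEq y y') : SEq (x.par y) (x'.par y') := by
  cases h; cases h'; exact .refl _

theorem boundary_congr {p q p' q' : GPath G.Arr a b} (hp : p = p') (hq : q = q') :
    (⟨a, b, p, q⟩ : Σ (a b : G.Obj) (_ : GPath G.Arr a b), GPath G.Arr a b) = ⟨a, b, p', q'⟩ := by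
  subst hp hq; rfl

/-- Related expressions have the same boundary. -/
theorem _root_.PinwheelDouble.TwoGraph.Rel.boundary {p q : GPath G.Arr a b}
    {p' q' : GPath G.Arr a' b'} {s : Expr G p q} {t : Expr G p' q'} (h : Rel G s t) :
    (⟨a, b, p, q⟩ : Σ (a b : G.Obj) (_ : GPath G.Arr a b), GPath G.Arr a b) = ⟨a', b', p', q'⟩ := by
  induction h with
  | refl | seq_assoc | interchange | seq_id | id_seq | par_id | par_ids => rfl
  | symm _ ih => exact ih.symm
  | trans _ _ ih ih' => exact ih.trans ih'
  | seq_congr _ _ ih ih' => cases ih; cases ih'; rfl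
  | par_congr _ _ ih ih' => cases ih; cases ih'; rfl
  | id_par s => exact boundary_congr (Quiver.Path.nil_comp _) (Quiver.Path.nil_comp _)
  | par_assoc s t w =>
    exact boundary_congr (Quiver.Path.comp_assoc _ _ _) (Quiver.Path.comp_assoc _ _ _)

theorem sound {p q : GPath G.Arr a b} {p' q' : GPath G.Arr a' b'} {s : Expr G p q}
    {t : Expr G p' q'} (h : Rel G s t) : SEq (mk s) (mk t) := by
  cases h.boundary
  have : mk s = mk t := Quotient.sound h
  rw [this]; exact .refl _

theorem id_seq {p q : GPath G.Arr a b} (x : Diagram G p q) : SEq ((id p).seq x) x :=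
  Quotient.inductionOn x fun s => sound (Rel.id_seq s)

theorem seq_id {p q : GPath G.Arr a b} (x : Diagram G p q) : SEq (x.seq (id q)) x :=
  Quotient.inductionOn x fun s => sound (Rel.seq_id s)

theorem seq_assoc {p q r m : GPath G.Arr a b} (x : Diagram G p q) (y : Diagram G q r)
    (z : Diagram G r m) : SEq ((x.seq y).seq z) (x.seq (y.seq z)) :=
  Quotient.inductionOn₃ x y z fun s t w => sound (Rel.seq_assoc s t w)

theorem id_par {p q : GPath G.Arr a b} (x : Diagram G p q) :
    SEq ((id (Quiver.Path.nil : GPath G.Arr a a)).par x) x :=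
  Quotient.inductionOn x fun s => sound (Rel.id_par s)

theorem par_id {p q : GPath G.Arr a b} (x : Diagram G p q) :
    SEq (x.par (id (Quiver.Path.nil : GPath G.Arr b b))) x :=
  Quotient.inductionOn x fun s => sound (Rel.par_id s)

theorem par_assoc {p q : GPath G.Arr a b} {m n : GPath G.Arr b c} {k l : GPath G.Arr c d}
    (x : Diagram G p q) (y : Diagram G m n) (z : Diagram G k l) :
    SEq ((x.par y).par z) (x.par (y.par z)) :=
  Quotient.inductionOn₃ x y z fun s t w => sound (Rel.par_assoc s t w)

theorem par_ids (p : GPath G.Arr a b) (q : GPath G.Arr b c) :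
    SEq ((id p).par (id q)) (id (p.comp q)) := sound (Rel.par_ids p q)

theorem interchange {p q r : GPath G.Arr a b} {m n l : GPath G.Arr b c} (x : Diagram G p q)
    (y : Diagram G q r) (x' : Diagram G m n) (y' : Diagram G n l) :
    SEq ((x.seq y).par (x'.seq y')) ((x.par x').seq (y.par y')) :=
  Quotient.inductionOn₂ x y fun s t => Quotient.inductionOn₂ x' y' fun s' t' =>
    sound (Rel.interchange s t s' t')

theorem id_congr {p p' : GPath G.Arr a b} (h : p = p') : SEq (id p) (id p') := by
  subst h; exact .refl _

/-- Sequential composition of diagrams along an equality of their common boundary. -/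
def glue {p q q' r : GPath G.Arr a b} (h : q = q') (x : Diagram G p q) (y : Diagram G q' r) :
    Diagram G p r :=
  x.seq (castD h.symm rfl y)

theorem SEq.mid {p q m r : GPath G.Arr a b} {p' q' m' r' : GPath G.Arr a' b'} {x : Diagram G p q}
    {y : Diagram G m r} {x' : Diagram G p' q'} {y' : Diagram G m' r'} (h : SEq x x')
    (h' : SEq y y') (e : q = m) : q' = m' := by
  cases h; cases h'; exact e

theorem SEq.glue {p q m r : GPath G.Arr a b} {p' q' m' r' : GPath G.Arr a' b'} {x : Diagram G p q}
    {y : Diagram G m r} {x' : Diagram G p' q'} {y' : Diagram G m' r'} (h : SEq x x')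
    (h' : SEq y y') (e : q = m) : SEq (glue e x y) (glue (h.mid h' e) x' y') := by
  cases h; cases h'; exact .refl _

theorem glue_assoc {p q q' r r' m : GPath G.Arr a b} (h : q = q') (h' : r = r')
    (x : Diagram G p q) (y : Diagram G q' r) (z : Diagram G r' m) :
    SEq (glue h' (glue h x y) z) (glue h x (glue h' y z)) := by
  subst h h'; exact seq_assoc _ _ _

theorem id_glue {p p' q : GPath G.Arr a b} (h : p' = p) (x : Diagram G p q) :
    SEq (glue h (id p') x) x := by
  subst h; exact id_seq x

theorem glue_id {p q q' : GPath G.Arr a b} (h : q = q') (x : Diagram G p q) :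
    SEq (glue h x (id q')) x := by
  subst h; exact seq_id x

theorem glue_par_id {p q q' r : GPath G.Arr a b} (h : q = q') (x : Diagram G p q)
    (y : Diagram G q' r) (m : GPath G.Arr b c) :
    SEq ((glue h x y).par (id m))
      (glue (congrArg (fun t => Quiver.Path.comp t m) h) (x.par (id m)) (y.par (id m))) := by
  subst h
  exact ((SEq.refl _).par (seq_id (id m)).symm).trans (interchange _ _ _ _)

theorem id_par_glue {p q q' r : GPath G.Arr b c} (h : q = q') (x : Diagram G p q)
    (y : Diagram G q' r) (m : GPath G.Arr a b) :
    SEq ((id m).par (glue h x y))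
      (glue (congrArg (fun t => Quiver.Path.comp m t) h) ((id m).par x) ((id m).par y)) := by
  subst h
  exact ((seq_id (id m)).symm.par (SEq.refl _)).trans (interchange _ _ _ _)

theorem par_eq_glue {p q : GPath G.Arr a b} {m n : GPath G.Arr b c} (x : Diagram G p q)
    (y : Diagram G m n) : SEq (glue rfl (x.par (id m)) ((id q).par y)) (x.par y) :=
  (interchange _ _ _ _).symm.trans ((seq_id x).par (id_seq y))

theorem par_eq_glue' {p q : GPath G.Arr a b} {m n : GPath G.Arr b c} (x : Diagram G p q)
    (y : Diagram G m n) : SEq (glue rfl ((id p).par y) (x.par (id n))) (x.par y) :=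
  (interchange _ _ _ _).symm.trans ((id_seq x).par (seq_id y))

theorem par_id_par_id {p q : GPath G.Arr a b} (x : Diagram G p q) (m : GPath G.Arr b c)
    (n : GPath G.Arr c d) : SEq ((x.par (id m)).par (id n)) (x.par (id (m.comp n))) :=
  (par_assoc _ _ _).trans ((SEq.refl _).par (par_ids _ _))

theorem id_par_id_par {p q : GPath G.Arr c d} (x : Diagram G p q) (m : GPath G.Arr a b)
    (n : GPath G.Arr b c) : SEq ((id m).par ((id n).par x)) ((id (m.comp n)).par x) :=
  (par_assoc _ _ _).symm.trans ((par_ids _ _).par (SEq.refl _))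

end SEq

end Diagram

/-- An interpretation of the 2-graph `G` in the free strict 2-category on `G'`: arrows go to paths
and 2-arrows go to string diagrams. In other words, a 2-graph morphism from `G` to the underlying
2-graph of the free 2-category on `G'`. -/
structure Interp (G G' : TwoGraph.{u}) : Type u where
  obj : G.Obj → G'.Obj
  arr : ∀ a b, G.Arr a b → GPath G'.Arr (obj a) (obj b)
  cell : ∀ {a b : G.Obj} (p q : GPath G.Arr a b), G.Cell p q →
    Diagram G' (bindPath obj arr p) (bindPath obj arr q)

namespace Interp

variable {G G' : TwoGraph.{u}} (I : Interp G G')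

/-- The induced map on paths. -/
abbrev path {a b : G.Obj} (p : GPath G.Arr a b) : GPath G'.Arr (I.obj a) (I.obj b) :=
  bindPath I.obj I.arr p

/-- The value of an expression under an interpretation. -/
def valExpr : ∀ {a b : G.Obj} {p q : GPath G.Arr a b}, Expr G p q →
    Diagram G' (I.path p) (I.path q)
  | _, _, _, _, .gen g => I.cell _ _ g
  | _, _, _, _, .id p => Diagram.id (I.path p)
  | _, _, _, _, .seq s t => (valExpr s).seq (valExpr t)
  | _, _, _, _, .par s t => Diagram.castD (bindPath_append _ _ _ _).symm
      (bindPath_append _ _ _ _).symm ((valExpr s).par (valExpr t))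

theorem valExpr_par {a b c : G.Obj} {p q : GPath G.Arr a b} {m n : GPath G.Arr b c}
    (s : Expr G p q) (t : Expr G m n) :
    Diagram.SEq (I.valExpr (s.par t)) ((I.valExpr s).par (I.valExpr t)) :=
  Diagram.castD_seq _ _ _

theorem valExpr_rel {a b : G.Obj} {p q : GPath G.Arr a b} {a' b' : G.Obj}
    {p' q' : GPath G.Arr a' b'} {s : Expr G p q} {t : Expr G p' q'} (h : Rel G s t) :
    Diagram.SEq (I.valExpr s) (I.valExpr t) := by
  induction h with
  | refl s => exact .refl _
  | symm _ ih => exact ih.symm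
  | trans _ _ ih ih' => exact ih.trans ih'
  | seq_congr _ _ ih ih' => exact ih.seq ih'
  | par_congr _ _ ih ih' =>
    exact (valExpr_par _ _ _).trans ((ih.par ih').trans (valExpr_par _ _ _).symm)
  | id_seq s => exact Diagram.id_seq _
  | seq_id s => exact Diagram.seq_id _
  | seq_assoc s t w => exact Diagram.seq_assoc _ _ _
  | id_par s => exact (valExpr_par _ _ _).trans (Diagram.id_par _)
  | par_id s => exact (valExpr_par _ _ _).trans (Diagram.par_id _)
  | par_assoc s t w =>
    refine (valExpr_par _ _ _).trans (((valExpr_par _ _ _).par (.refl _)).trans ?_)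
    refine (Diagram.par_assoc _ _ _).trans (Diagram.SEq.trans ?_ (valExpr_par _ _ _).symm)
    exact (Diagram.SEq.refl _).par (valExpr_par _ _ _).symm
  | par_ids p q =>
    exact (valExpr_par _ _ _).trans ((Diagram.par_ids _ _).trans
      (Diagram.id_congr (bindPath_append _ _ _ _).symm))
  | interchange s t s' t' =>
    refine (valExpr_par _ _ _).trans ((Diagram.interchange _ _ _ _).trans ?_)
    exact (valExpr_par _ _ _).symm.seq (valExpr_par _ _ _).symm

/-- The value of a diagram under an interpretation: the action on 2-cells of the unique strict
2-functor that extends the interpretation. -/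
def eval {a b : G.Obj} {p q : GPath G.Arr a b} (x : Diagram G p q) :
    Diagram G' (I.path p) (I.path q) :=
  Quotient.liftOn x (fun s => I.valExpr s) (fun _ _ h => (I.valExpr_rel h).eq)

theorem eval_gen {a b : G.Obj} {p q : GPath G.Arr a b} (g : G.Cell p q) :
    I.eval (Diagram.gen g) = I.cell p q g := rfl

theorem eval_id {a b : G.Obj} (p : GPath G.Arr a b) :
    I.eval (Diagram.id p) = Diagram.id (I.path p) := rfl

theorem eval_seq {a b : G.Obj} {p q r : GPath G.Arr a b} (x : Diagram G p q)
    (y : Diagram G q r) : I.eval (x.seq y) = (I.eval x).seq (I.eval y) :=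
  Quotient.inductionOn₂ x y fun _ _ => rfl

theorem eval_par {a b c : G.Obj} {p q : GPath G.Arr a b} {m n : GPath G.Arr b c}
    (x : Diagram G p q) (y : Diagram G m n) :
    Diagram.SEq (I.eval (x.par y)) ((I.eval x).par (I.eval y)) :=
  Quotient.inductionOn₂ x y fun _ _ => I.valExpr_par _ _

theorem eval_congr {a b a' b' : G.Obj} {p q : GPath G.Arr a b} {p' q' : GPath G.Arr a' b'}
    {x : Diagram G p q} {y : Diagram G p' q'} (h : Diagram.SEq x y) :
    Diagram.SEq (I.eval x) (I.eval y) := by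
  cases h; exact .refl _

theorem eval_glue {a b : G.Obj} {p q q' r : GPath G.Arr a b} (h : q = q') (x : Diagram G p q)
    (y : Diagram G q' r) :
    Diagram.SEq (I.eval (Diagram.glue h x y))
      (Diagram.glue (congrArg I.path h) (I.eval x) (I.eval y)) := by
  subst h
  exact (Diagram.SEq.of_heq rfl rfl (heq_of_eq (I.eval_seq x y)))

/-- Evaluating in the interpretation of generators by themselves does nothing. -/
theorem eval_self {arr : ∀ a b, G.Arr a b → GPath G.Arr a b}
    {cell : ∀ {a b : G.Obj} (p q : GPath G.Arr a b), G.Cell p q →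
      Diagram G (bindPath (fun x => x) arr p) (bindPath (fun x => x) arr q)}
    (harr : ∀ a b e, arr a b e = single e)
    (hcell : ∀ {a b : G.Obj} (p q : GPath G.Arr a b) (g : G.Cell p q),
      Diagram.SEq (cell p q g) (Diagram.gen g))
    {a b : G.Obj} {p q : GPath G.Arr a b} (x : Diagram G p q) :
    Diagram.SEq (eval ⟨fun x => x, arr, cell⟩ x) x := by
  obtain rfl : arr = fun _ _ e => single e := by funext a b e; exact harr a b e
  have hp : ∀ {a b : G.Obj} (p : GPath G.Arr a b),
      bindPath (E' := G.Arr) (fun x => x) (fun _ _ e => single e) p = p := by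
    intro a b p
    induction p with
    | nil => rfl
    | cons p e ih => exact congrArg (fun r => Quiver.Path.cons (V := Gr G.Arr) r e) ih
  refine Quotient.inductionOn x fun s => ?_
  induction s with
  | gen g => exact hcell _ _ g
  | id p => exact Diagram.id_congr (hp p)
  | seq s t ih ih' => exact (ih (Diagram.mk s)).seq (ih' (Diagram.mk t))
  | par s t ih ih' =>
    exact (valExpr_par _ _ _).trans ((ih (Diagram.mk s)).par (ih' (Diagram.mk t)))

/-- Evaluating twice is evaluating in the composite interpretation. -/
theorem eval_eval {G'' : TwoGraph.{u}} (J : Interp G' G'')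
    {arr : ∀ a b, G.Arr a b → GPath G''.Arr (J.obj (I.obj a)) (J.obj (I.obj b))}
    {cell : ∀ {a b : G.Obj} (p q : GPath G.Arr a b), G.Cell p q →
      Diagram G'' (bindPath (fun x => J.obj (I.obj x)) arr p)
        (bindPath (fun x => J.obj (I.obj x)) arr q)}
    (harr : ∀ a b e, J.path (I.arr a b e) = arr a b e)
    (hcell : ∀ {a b : G.Obj} (p q : GPath G.Arr a b) (g : G.Cell p q),
      Diagram.SEq (J.eval (I.cell p q g)) (cell p q g))
    {a b : G.Obj} {p q : GPath G.Arr a b} (x : Diagram G p q) :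
    Diagram.SEq (J.eval (I.eval x)) (eval ⟨fun x => J.obj (I.obj x), arr, cell⟩ x) := by
  obtain rfl : (fun a b e => J.path (I.arr a b e)) = arr := by funext a b e; exact harr a b e
  have hp : ∀ {a b : G.Obj} (p : GPath G.Arr a b),
      J.path (I.path p) = bindPath (fun x => J.obj (I.obj x))
        (fun a b e => J.path (I.arr a b e)) p := by
    intro a b p
    induction p with
    | nil => rfl
    | cons p e ih =>
      exact (bindPath_append _ _ _ _).trans (congrArg (fun r => Quiver.Path.comp r _) ih)
  refine Quotient.inductionOn x fun s => ?_
  induction s with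
  | gen g => exact hcell _ _ g
  | id p => exact Diagram.id_congr (hp p)
  | seq s t ih ih' =>
    refine Diagram.SEq.trans ?_ ((ih (Diagram.mk s)).seq (ih' (Diagram.mk t)))
    exact Diagram.SEq.of_heq rfl rfl (heq_of_eq (J.eval_seq _ _))
  | par s t ih ih' =>
    refine Diagram.SEq.trans ?_ (valExpr_par _ _ _).symm
    refine Diagram.SEq.trans ?_ ((ih (Diagram.mk s)).par (ih' (Diagram.mk t)))
    exact (J.eval_congr (valExpr_par _ _ _)).trans (J.eval_par _ _)

end Interp

end TwoGraph

/-! ## The tilted 2-graph -/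

open TwoGraph

namespace DoubleSig

/-- The arrows of the tilted 2-graph: vertical and horizontal edges together. -/
abbrev TiltArr (S : DoubleSig.{u}) (X Y : S.Obj) : Type u := S.V X Y ⊕ S.H X Y

/-- A path of vertical edges as a path in the tilted 2-graph. -/
def verPath (S : DoubleSig.{u}) {X Y : S.Obj} (p : GPath S.V X Y) : GPath S.TiltArr X Y :=
  mapPath (fun X => X) (fun _ _ e => Sum.inl e) p

/-- A path of horizontal edges as a path in the tilted 2-graph. -/
def horPath (S : DoubleSig.{u}) {X Y : S.Obj} (p : GPath S.H X Y) : GPath S.TiltArr X Y :=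
  mapPath (fun X => X) (fun _ _ e => Sum.inr e) p

/-- The 2-arrows of the tilted 2-graph: those of the form `u, h ⟶ k, v` are the cells with these
boundaries, and there are no others. -/
inductive TiltCell (S : DoubleSig.{u}) :
    ∀ {X W : S.Obj}, GPath S.TiltArr X W → GPath S.TiltArr X W → Type u
  | mk {X Y Z W : S.Obj} (u : GPath S.V X Y) (h : GPath S.H Y W) (k : GPath S.H X Z)
      (v : GPath S.V Z W) (d : S.Cell u h k v) :
      TiltCell S ((S.verPath u).comp (S.horPath h)) ((S.horPath k).comp (S.verPath v))

/-- The tilted 2-graph of a double signature. -/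
def tilt (S : DoubleSig.{u}) : TwoGraph.{u} where
  Obj := S.Obj
  Arr := S.TiltArr
  Cell p q := S.TiltCell p q

theorem verPath_comp (S : DoubleSig.{u}) {X Y Z : S.Obj} (p : GPath S.V X Y) (q : GPath S.V Y Z) :
    S.verPath (p.comp q) = (S.verPath p).comp (S.verPath q) := mapPath_append _ _ _ _

theorem horPath_comp (S : DoubleSig.{u}) {X Y Z : S.Obj} (p : GPath S.H X Y) (q : GPath S.H Y Z) :
    S.horPath (p.comp q) = (S.horPath p).comp (S.horPath q) := mapPath_append _ _ _ _

end DoubleSig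

/-! ## The double category of pinwheel diagrams -/

section pinwheelObj

variable (S : DoubleSig.{u})

/-- The cells of the pinwheel double category: string diagrams on the tilted 2-graph from
`u` followed by `h` to `k` followed by `v`. -/
abbrev PCell {X Y Z W : S.Obj} (u : GPath S.V X Y) (h : GPath S.H Y W) (k : GPath S.H X Z)
    (v : GPath S.V Z W) : Type u :=
  Diagram S.tilt ((S.verPath u).comp (S.horPath h)) ((S.horPath k).comp (S.verPath v))

variable {S}
variable {X Y Z W P Q : S.Obj}

/-- The horizontal identity on a vertical path: the identity diagram. -/
def pIdV (u : GPath S.V X Y) :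
    PCell S u (Quiver.Path.nil : GPath S.H Y Y) (Quiver.Path.nil : GPath S.H X X) u :=
  Diagram.castD rfl (Quiver.Path.nil_comp (S.verPath u)).symm
    (Diagram.id (G := S.tilt) (S.verPath u))

/-- The vertical identity on a horizontal path: the identity diagram. -/
def pIdH (h : GPath S.H X Y) :
    PCell S (Quiver.Path.nil : GPath S.V X X) h h (Quiver.Path.nil : GPath S.V Y Y) :=
  Diagram.castD (Quiver.Path.nil_comp (S.horPath h)).symm rfl
    (Diagram.id (G := S.tilt) (S.horPath h))

/-- Horizontal composition: `u, h, h' ⟶ k, v, h' ⟶ k, k', w`. -/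
def pHcomp {u : GPath S.V X Y} {h : GPath S.H Y W} {k : GPath S.H X Z} {v : GPath S.V Z W}
    {h' : GPath S.H W Q} {k' : GPath S.H Z P} {w : GPath S.V P Q} (a : PCell S u h k v)
    (b : PCell S v h' k' w) : PCell S u (h.comp h') (k.comp k') w :=
  Diagram.castD
    ((Quiver.Path.comp_assoc _ _ _).trans (congrArg _ (S.horPath_comp h h').symm))
    ((Quiver.Path.comp_assoc _ _ _).symm.trans
      (congrArg (fun r => Quiver.Path.comp r (S.verPath w)) (S.horPath_comp k k').symm))
    (Diagram.glue (Quiver.Path.comp_assoc _ _ _) (a.par (Diagram.id (G := S.tilt) (S.horPath h')))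
      ((Diagram.id (G := S.tilt) (S.horPath k)).par b))

/-- Vertical composition: `u, u', i ⟶ u, h, v' ⟶ k, v, v'`. -/
def pVcomp {u : GPath S.V X Y} {h : GPath S.H Y W} {k : GPath S.H X Z} {v : GPath S.V Z W}
    {u' : GPath S.V Y P} {i : GPath S.H P Q} {v' : GPath S.V W Q} (a : PCell S u h k v)
    (b : PCell S u' i h v') : PCell S (u.comp u') i k (v.comp v') :=
  Diagram.castD
    ((Quiver.Path.comp_assoc _ _ _).symm.trans
      (congrArg (fun r => Quiver.Path.comp r (S.horPath i)) (S.verPath_comp u u').symm))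
    ((Quiver.Path.comp_assoc _ _ _).trans (congrArg _ (S.verPath_comp v v').symm))
    (Diagram.glue (Quiver.Path.comp_assoc _ _ _).symm ((Diagram.id (G := S.tilt) (S.verPath u)).par b)
      (a.par (Diagram.id (G := S.tilt) (S.verPath v'))))

theorem pHcomp_seq {u : GPath S.V X Y} {h : GPath S.H Y W} {k : GPath S.H X Z} {v : GPath S.V Z W}
    {h' : GPath S.H W Q} {k' : GPath S.H Z P} {w : GPath S.V P Q} (a : PCell S u h k v)
    (b : PCell S v h' k' w) :
    Diagram.SEq (pHcomp a b) (Diagram.glue (Quiver.Path.comp_assoc _ _ _)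
      (a.par (Diagram.id (G := S.tilt) (S.horPath h')))
      ((Diagram.id (G := S.tilt) (S.horPath k)).par b)) := Diagram.castD_seq _ _ _

theorem pVcomp_seq {u : GPath S.V X Y} {h : GPath S.H Y W} {k : GPath S.H X Z} {v : GPath S.V Z W}
    {u' : GPath S.V Y P} {i : GPath S.H P Q} {v' : GPath S.V W Q} (a : PCell S u h k v)
    (b : PCell S u' i h v') :
    Diagram.SEq (pVcomp a b) (Diagram.glue (Quiver.Path.comp_assoc _ _ _).symm
      ((Diagram.id (G := S.tilt) (S.verPath u)).par b)
      (a.par (Diagram.id (G := S.tilt) (S.verPath v')))) := Diagram.castD_seq _ _ _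

theorem pIdV_seq (u : GPath S.V X Y) :
    Diagram.SEq (pIdV u) (Diagram.id (G := S.tilt) (S.verPath u)) := Diagram.castD_seq _ _ _

theorem pIdH_seq (h : GPath S.H X Y) :
    Diagram.SEq (pIdH h) (Diagram.id (G := S.tilt) (S.horPath h)) := Diagram.castD_seq _ _ _

theorem id_horPath_comp (h : GPath S.H X Y) (k : GPath S.H Y Z) :
    Diagram.SEq (Diagram.id (G := S.tilt) (S.horPath (h.comp k)))
      (Diagram.id (G := S.tilt) ((S.horPath h).comp (S.horPath k))) :=
  Diagram.id_congr (S.horPath_comp h k)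

theorem id_verPath_comp (h : GPath S.V X Y) (k : GPath S.V Y Z) :
    Diagram.SEq (Diagram.id (G := S.tilt) (S.verPath (h.comp k)))
      (Diagram.id (G := S.tilt) ((S.verPath h).comp (S.verPath k))) :=
  Diagram.id_congr (S.verPath_comp h k)

theorem pHcomp_assoc {R T : S.Obj} {u : GPath S.V X Y} {h : GPath S.H Y W} {k : GPath S.H X Z}
    {v : GPath S.V Z W} {h' : GPath S.H W Q} {k' : GPath S.H Z P} {w : GPath S.V P Q}
    {h'' : GPath S.H Q T} {k'' : GPath S.H P R} {x : GPath S.V R T} (a : PCell S u h k v)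
    (b : PCell S v h' k' w) (c : PCell S w h'' k'' x) :
    Diagram.SEq (pHcomp (pHcomp a b) c) (pHcomp a (pHcomp b c)) := by
  refine (pHcomp_seq _ _).trans (Diagram.SEq.trans ?_ (pHcomp_seq _ _).symm)
  refine (((pHcomp_seq a b).par (.refl _)).glue
    ((id_horPath_comp k k').par (.refl c)) _).trans ?_
  refine Diagram.SEq.trans ?_ ((((Diagram.SEq.refl a).par (id_horPath_comp h' h'')).glue
    ((Diagram.SEq.refl _).par (pHcomp_seq b c)) _).symm)
  refine ((Diagram.glue_par_id _ _ _ _).glue (.refl _) _).trans ?_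
  refine (Diagram.glue_assoc _ _ _ _ _).trans ?_
  refine Diagram.SEq.trans ?_ ((Diagram.SEq.refl _).glue (Diagram.id_par_glue _ _ _ _) _).symm
  exact (Diagram.par_id_par_id _ _ _).glue ((Diagram.par_assoc _ _ _).glue
    (Diagram.id_par_id_par _ _ _).symm _) _

theorem pVcomp_assoc {R T : S.Obj} {u : GPath S.V X Y} {h : GPath S.H Y W} {k : GPath S.H X Z}
    {v : GPath S.V Z W} {u' : GPath S.V Y P} {i : GPath S.H P Q} {v' : GPath S.V W Q}
    {u'' : GPath S.V P R} {j : GPath S.H R T} {v'' : GPath S.V Q T} (a : PCell S u h k v)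
    (b : PCell S u' i h v') (c : PCell S u'' j i v'') :
    Diagram.SEq (pVcomp (pVcomp a b) c) (pVcomp a (pVcomp b c)) := by
  refine (pVcomp_seq _ _).trans (Diagram.SEq.trans ?_ (pVcomp_seq _ _).symm)
  refine (((id_verPath_comp u u').par (.refl c)).glue
    ((pVcomp_seq a b).par (.refl _)) _).trans ?_
  refine Diagram.SEq.trans ?_ (((Diagram.SEq.refl _).par (pVcomp_seq b c)).glue
    ((Diagram.SEq.refl a).par (id_verPath_comp v' v'')) _).symm
  refine ((Diagram.SEq.refl _).glue (Diagram.glue_par_id _ _ _ _) _).trans ?_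
  refine Diagram.SEq.trans ?_ ((Diagram.id_par_glue _ _ _ _).glue (Diagram.SEq.refl _) _).symm
  refine Diagram.SEq.trans ?_ (Diagram.glue_assoc _ _ _ _ _).symm
  exact (Diagram.id_par_id_par _ _ _).symm.glue ((Diagram.par_assoc _ _ _).glue
    (Diagram.par_id_par_id _ _ _) _) _

theorem pIdV_hcomp {u : GPath S.V X Y} {h : GPath S.H Y W} {k : GPath S.H X Z}
    {v : GPath S.V Z W} (a : PCell S u h k v) : Diagram.SEq (pHcomp (pIdV u) a) a := by
  refine (pHcomp_seq _ _).trans ?_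
  refine ((((pIdV_seq u).par (.refl _)).trans (Diagram.par_ids _ _)).glue
    (Diagram.id_par a) _).trans ?_
  exact Diagram.id_glue _ _

theorem hcomp_pIdV {u : GPath S.V X Y} {h : GPath S.H Y W} {k : GPath S.H X Z}
    {v : GPath S.V Z W} (a : PCell S u h k v) : Diagram.SEq (pHcomp a (pIdV v)) a := by
  refine (pHcomp_seq _ _).trans ?_
  refine ((Diagram.par_id a).glue
    (((Diagram.SEq.refl _).par (pIdV_seq v)).trans (Diagram.par_ids _ _)) _).trans ?_
  exact Diagram.glue_id _ _

theorem pIdH_vcomp {u : GPath S.V X Y} {h : GPath S.H Y W} {k : GPath S.H X Z}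
    {v : GPath S.V Z W} (a : PCell S u h k v) : Diagram.SEq (pVcomp (pIdH k) a) a := by
  refine (pVcomp_seq _ _).trans ?_
  refine ((Diagram.id_par a).glue
    (((pIdH_seq k).par (.refl _)).trans (Diagram.par_ids _ _)) _).trans ?_
  exact Diagram.glue_id _ _

theorem vcomp_pIdH {u : GPath S.V X Y} {h : GPath S.H Y W} {k : GPath S.H X Z}
    {v : GPath S.V Z W} (a : PCell S u h k v) : Diagram.SEq (pVcomp a (pIdH h)) a := by
  refine (pVcomp_seq _ _).trans ?_
  refine ((((Diagram.SEq.refl _).par (pIdH_seq h)).trans (Diagram.par_ids _ _)).glue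
    (Diagram.par_id a) _).trans ?_
  exact Diagram.id_glue _ _

theorem pIdV_comp (u : GPath S.V X Y) (v : GPath S.V Y Z) :
    Diagram.SEq (pIdV (u.comp v)) (pVcomp (pIdV u) (pIdV v)) := by
  refine (pIdV_seq _).trans ((id_verPath_comp u v).trans (Diagram.SEq.symm ?_))
  refine (pVcomp_seq _ _).trans ?_
  refine ((((Diagram.SEq.refl _).par (pIdV_seq v)).trans (Diagram.par_ids _ _)).glue
    (((pIdV_seq u).par (.refl _)).trans (Diagram.par_ids _ _)) _).trans ?_
  exact Diagram.glue_id _ _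

theorem pIdH_comp (h : GPath S.H X Y) (k : GPath S.H Y Z) :
    Diagram.SEq (pIdH (h.comp k)) (pHcomp (pIdH h) (pIdH k)) := by
  refine (pIdH_seq _).trans ((id_horPath_comp h k).trans (Diagram.SEq.symm ?_))
  refine (pHcomp_seq _ _).trans ?_
  refine ((((pIdH_seq h).par (.refl _)).trans (Diagram.par_ids _ _)).glue
    (((Diagram.SEq.refl _).par (pIdH_seq k)).trans (Diagram.par_ids _ _)) _).trans ?_
  exact Diagram.glue_id _ _

theorem p_interchange {R T U : S.Obj} {u : GPath S.V X Y} {h : GPath S.H Y W} {k : GPath S.H X Z}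
    {v : GPath S.V Z W} {h' : GPath S.H W Q} {k' : GPath S.H Z P} {w : GPath S.V P Q}
    {u' : GPath S.V Y R} {i : GPath S.H R T} {v' : GPath S.V W T} {i' : GPath S.H T U}
    {w' : GPath S.V Q U} (a : PCell S u h k v) (b : PCell S v h' k' w) (c : PCell S u' i h v')
    (d : PCell S v' i' h' w') :
    Diagram.SEq (pVcomp (pHcomp a b) (pHcomp c d)) (pHcomp (pVcomp a c) (pVcomp b d)) := by
  refine (pVcomp_seq _ _).trans (Diagram.SEq.trans ?_ (pHcomp_seq _ _).symm)
  refine (((Diagram.SEq.refl _).par (pHcomp_seq c d)).glue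
    ((pHcomp_seq a b).par (.refl _)) _).trans ?_
  refine Diagram.SEq.trans ?_ (((pVcomp_seq a c).par (.refl _)).glue
    ((Diagram.SEq.refl _).par (pVcomp_seq b d)) _).symm
  refine ((Diagram.id_par_glue _ _ _ _).glue (Diagram.glue_par_id _ _ _ _) _).trans ?_
  refine Diagram.SEq.trans ?_
    ((Diagram.glue_par_id _ _ _ _).glue (Diagram.id_par_glue _ _ _ _) _).symm
  refine (Diagram.glue_assoc _ _ _ _ _).trans
    (Diagram.SEq.trans ?_ (Diagram.glue_assoc _ _ _ _ _).symm)
  refine (Diagram.par_assoc _ _ _).symm.glue ?_ _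
  refine (Diagram.glue_assoc _ _ _ _ _).symm.trans
    (Diagram.SEq.trans ?_ (Diagram.glue_assoc _ _ _ _ _))
  refine Diagram.SEq.glue ?_ (Diagram.par_assoc _ _ _) _
  refine (((Diagram.id_par_id_par _ _ _).glue (Diagram.par_id_par_id _ _ _) _).trans
    (Diagram.par_eq_glue' a d)).trans ?_
  exact (((Diagram.par_id_par_id _ _ _).glue (Diagram.id_par_id_par _ _ _) _).trans
    (Diagram.par_eq_glue a d)).symm

end pinwheelObj

/-- The double category of pinwheel diagrams over a double signature. -/
def pinwheelObj (S : DoubleSig.{u}) : DoubleCat.{u} where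
  Obj := S.Obj
  hcat := pathCat S.H
  vcat := pathCat S.V
  Cell u h k v := PCell S u h k v
  idV u := pIdV u
  idH h := pIdH h
  hcomp a b := pHcomp a b
  vcomp a b := pVcomp a b
  hcomp_assoc a b c := (pHcomp_assoc a b c).heq
  vcomp_assoc a b c := (pVcomp_assoc a b c).heq
  idV_hcomp a := (pIdV_hcomp a).heq
  hcomp_idV a := (hcomp_pIdV a).heq
  idH_vcomp a := (pIdH_vcomp a).heq
  vcomp_idH a := (vcomp_pIdH a).heq
  idV_id _ := rfl
  idV_comp u v := (pIdV_comp u v).eq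
  idH_comp h k := (pIdH_comp h k).eq
  interchange a b c d := (p_interchange a b c d).eq

/-! ## Functoriality of the construction -/

section pinwheelMap

variable {S T : DoubleSig.{u}} (f : DoubleSig.Hom S T)

/-- The action on arrows of the tilted 2-graphs. -/
def tiltArr (X Y : S.Obj) : S.TiltArr X Y → GPath T.TiltArr (f.obj X) (f.obj Y)
  | .inl e => single (.inl (f.ver X Y e))
  | .inr e => single (.inr (f.hor X Y e))

theorem bindPath_tiltArr_verPath {X Y : S.Obj} (p : GPath S.V X Y) :
    bindPath f.obj (tiltArr f) (S.verPath p) = T.verPath (mapPath f.obj f.ver p) := by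
  induction p with
  | nil => rfl
  | cons p e ih =>
    exact congrArg (fun r => Quiver.Path.cons (V := Gr T.TiltArr) r (.inl (f.ver _ _ e))) ih

theorem bindPath_tiltArr_horPath {X Y : S.Obj} (p : GPath S.H X Y) :
    bindPath f.obj (tiltArr f) (S.horPath p) = T.horPath (mapPath f.obj f.hor p) := by
  induction p with
  | nil => rfl
  | cons p e ih =>
    exact congrArg (fun r => Quiver.Path.cons (V := Gr T.TiltArr) r (.inr (f.hor _ _ e))) ih

theorem bindPath_tiltArr_verhor {X Y Z : S.Obj} (p : GPath S.V X Y) (q : GPath S.H Y Z) :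
    bindPath f.obj (tiltArr f) ((S.verPath p).comp (S.horPath q))
      = (T.verPath (mapPath f.obj f.ver p)).comp (T.horPath (mapPath f.obj f.hor q)) := by
  refine (bindPath_append _ _ _ _).trans ?_
  exact congrArg₂ (fun r s => Quiver.Path.comp r s) (bindPath_tiltArr_verPath f p)
    (bindPath_tiltArr_horPath f q)

theorem bindPath_tiltArr_horver {X Y Z : S.Obj} (p : GPath S.H X Y) (q : GPath S.V Y Z) :
    bindPath f.obj (tiltArr f) ((S.horPath p).comp (S.verPath q))
      = (T.horPath (mapPath f.obj f.hor p)).comp (T.verPath (mapPath f.obj f.ver q)) := by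
  refine (bindPath_append _ _ _ _).trans ?_
  exact congrArg₂ (fun r s => Quiver.Path.comp r s) (bindPath_tiltArr_horPath f p)
    (bindPath_tiltArr_verPath f q)

/-- The action on 2-arrows of the tilted 2-graphs: the generator on a cell `d` goes to the
generator on the image of `d`. -/
def tiltCell : ∀ {X W : S.Obj} (p q : GPath S.TiltArr X W), S.TiltCell p q →
    Diagram T.tilt (bindPath f.obj (tiltArr f) p) (bindPath f.obj (tiltArr f) q)
  | _, _, _, _, .mk u h k v d => Diagram.castD (bindPath_tiltArr_verhor f u h).symm
      (bindPath_tiltArr_horver f k v).symm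
      (Diagram.gen (G := T.tilt) (DoubleSig.TiltCell.mk _ _ _ _ (f.cell u h k v d)))

/-- The relabelling of string diagrams on tilted 2-graphs. -/
def tiltInterp : Interp S.tilt T.tilt where
  obj := f.obj
  arr := tiltArr f
  cell p q g := tiltCell f p q g

theorem tiltCell_seq {X Y Z W : S.Obj} (u : GPath S.V X Y) (h : GPath S.H Y W)
    (k : GPath S.H X Z) (v : GPath S.V Z W) (d : S.Cell u h k v) :
    Diagram.SEq (tiltCell f _ _ (DoubleSig.TiltCell.mk u h k v d))
      (Diagram.gen (G := T.tilt) (DoubleSig.TiltCell.mk _ _ _ _ (f.cell u h k v d))) :=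
  Diagram.castD_seq (bindPath_tiltArr_verhor f u h).symm (bindPath_tiltArr_horver f k v).symm _

theorem eval_id_verPath {X Y : S.Obj} (p : GPath S.V X Y) :
    Diagram.SEq ((tiltInterp f).eval (Diagram.id (G := S.tilt) (S.verPath p)))
      (Diagram.id (G := T.tilt) (T.verPath (mapPath f.obj f.ver p))) :=
  Diagram.id_congr (bindPath_tiltArr_verPath f p)

theorem eval_id_horPath {X Y : S.Obj} (p : GPath S.H X Y) :
    Diagram.SEq ((tiltInterp f).eval (Diagram.id (G := S.tilt) (S.horPath p)))
      (Diagram.id (G := T.tilt) (T.horPath (mapPath f.obj f.hor p))) :=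
  Diagram.id_congr (bindPath_tiltArr_horPath f p)

/-- The action of a double signature morphism on pinwheel diagrams. -/
def pMap {X Y Z W : S.Obj} (u : GPath S.V X Y) (h : GPath S.H Y W) (k : GPath S.H X Z)
    (v : GPath S.V Z W) (x : PCell S u h k v) :
    PCell T (mapPath f.obj f.ver u) (mapPath f.obj f.hor h) (mapPath f.obj f.hor k)
      (mapPath f.obj f.ver v) :=
  Diagram.castD (bindPath_tiltArr_verhor f u h) (bindPath_tiltArr_horver f k v)
    ((tiltInterp f).eval x)

theorem pMap_seq {X Y Z W : S.Obj} (u : GPath S.V X Y) (h : GPath S.H Y W) (k : GPath S.H X Z)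
    (v : GPath S.V Z W) (x : PCell S u h k v) :
    Diagram.SEq (pMap f u h k v x) ((tiltInterp f).eval x) := Diagram.castD_seq _ _ _

/-- The double functor of pinwheel diagrams induced by a double signature morphism. -/
def pinwheelMap : DoubleFunctor (pinwheelObj S) (pinwheelObj T) where
  obj := f.obj
  hor _ _ p := mapPath f.obj f.hor p
  ver _ _ p := mapPath f.obj f.ver p
  hor_id _ := rfl
  hor_comp _ _ _ p q := mapPath_append _ _ p q
  ver_id _ := rfl
  ver_comp _ _ _ p q := mapPath_append _ _ p q
  cell u h k v x := pMap f u h k v x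
  cell_idV u := by
    refine Diagram.SEq.heq ((pMap_seq f _ _ _ _ _).trans ?_)
    refine (Interp.eval_congr _ (pIdV_seq u)).trans (Diagram.SEq.trans ?_ (pIdV_seq _).symm)
    exact Diagram.id_congr (bindPath_tiltArr_verPath f u)
  cell_idH h := by
    refine Diagram.SEq.heq ((pMap_seq f _ _ _ _ _).trans ?_)
    refine (Interp.eval_congr _ (pIdH_seq h)).trans (Diagram.SEq.trans ?_ (pIdH_seq _).symm)
    exact Diagram.id_congr (bindPath_tiltArr_horPath f h)
  cell_hcomp a b := by
    refine Diagram.SEq.heq ((pMap_seq f _ _ _ _ _).trans ?_)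
    refine (Interp.eval_congr _ (pHcomp_seq a b)).trans
      (Diagram.SEq.trans ?_ (pHcomp_seq _ _).symm)
    refine (Interp.eval_glue _ _ _ _).trans ?_
    exact ((Interp.eval_par _ _ _).trans ((pMap_seq f _ _ _ _ a).symm.par
      (eval_id_horPath f _))).glue
      ((Interp.eval_par _ _ _).trans (Diagram.SEq.par
        (eval_id_horPath f _) (pMap_seq f _ _ _ _ b).symm)) _
  cell_vcomp a b := by
    refine Diagram.SEq.heq ((pMap_seq f _ _ _ _ _).trans ?_)
    refine (Interp.eval_congr _ (pVcomp_seq a b)).trans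
      (Diagram.SEq.trans ?_ (pVcomp_seq _ _).symm)
    refine (Interp.eval_glue _ _ _ _).trans ?_
    exact ((Interp.eval_par _ _ _).trans (Diagram.SEq.par
        (eval_id_verPath f _) (pMap_seq f _ _ _ _ b).symm)).glue
      ((Interp.eval_par _ _ _).trans ((pMap_seq f _ _ _ _ a).symm.par
      (eval_id_verPath f _))) _

end pinwheelMap

theorem tiltGen_congr {S : DoubleSig.{u}} {X Y Z W : S.Obj} {u u' : GPath S.V X Y}
    {h h' : GPath S.H Y W} {k k' : GPath S.H X Z} {v v' : GPath S.V Z W} (hu : u = u')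
    (hh : h = h') (hk : k = k') (hv : v = v') {d : S.Cell u h k v} {d' : S.Cell u' h' k' v'}
    (hd : HEq d d') :
    Diagram.SEq (Diagram.gen (G := S.tilt) (DoubleSig.TiltCell.mk u h k v d))
      (Diagram.gen (G := S.tilt) (DoubleSig.TiltCell.mk u' h' k' v' d')) := by
  subst hu hh hk hv
  cases hd
  exact .refl _

theorem pMap_id {S : DoubleSig.{u}} {X Y Z W : S.Obj} (u : GPath S.V X Y) (h : GPath S.H Y W)
    (k : GPath S.H X Z) (v : GPath S.V Z W) (x : PCell S u h k v) :
    Diagram.SEq (pMap (DoubleSig.Hom.id S) u h k v x) x := by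
  refine (pMap_seq _ _ _ _ _ x).trans ?_
  refine Interp.eval_self (G := S.tilt) (arr := tiltArr (DoubleSig.Hom.id S))
    (cell := fun p q g => tiltCell (DoubleSig.Hom.id S) p q g) ?_ ?_ x
  · rintro a b (e | e) <;> rfl
  · rintro a b _ _ ⟨u, h, k, v, d⟩
    exact (tiltCell_seq _ _ _ _ _ _).trans (tiltGen_congr (mapPath_id u) (mapPath_id h)
      (mapPath_id k) (mapPath_id v) (cast_heq _ _))

theorem pMap_comp {S T R : DoubleSig.{u}} (f : DoubleSig.Hom S T) (g : DoubleSig.Hom T R)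
    {X Y Z W : S.Obj} (u : GPath S.V X Y) (h : GPath S.H Y W) (k : GPath S.H X Z)
    (v : GPath S.V Z W) (x : PCell S u h k v) :
    Diagram.SEq (pMap (f.comp g) u h k v x) (pMap g _ _ _ _ (pMap f u h k v x)) := by
  refine (pMap_seq _ _ _ _ _ x).trans (Diagram.SEq.symm ?_)
  refine (pMap_seq _ _ _ _ _ _).trans ((Interp.eval_congr _ (pMap_seq _ _ _ _ _ x)).trans ?_)
  refine Interp.eval_eval (tiltInterp f) (tiltInterp g) (arr := tiltArr (f.comp g))
    (cell := fun p q d => tiltCell (f.comp g) p q d) ?_ ?_ x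
  · rintro a b (e | e) <;> rfl
  · rintro a b _ _ ⟨u, h, k, v, d⟩
    refine (Interp.eval_congr _ (tiltCell_seq f _ _ _ _ d)).trans ?_
    refine (tiltCell_seq g _ _ _ _ (f.cell u h k v d)).trans
      (Diagram.SEq.trans ?_ (tiltCell_seq (f.comp g) _ _ _ _ d).symm)
    exact tiltGen_congr (mapPath_mapPath f.obj f.ver g.obj g.ver u)
      (mapPath_mapPath f.obj f.hor g.obj g.hor h) (mapPath_mapPath f.obj f.hor g.obj g.hor k)
      (mapPath_mapPath f.obj f.ver g.obj g.ver v) (cast_heq _ _).symm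

/-- The functor of pinwheel diagrams, from double signatures to strict double categories. -/
def pinwheel : DoubleSig.{u} ⥤ DoubleCat.{u} where
  obj := pinwheelObj
  map f := pinwheelMap f
  map_id _ := DoubleFunctor.ext_cell rfl (fun _ _ p => heq_of_eq (mapPath_id p))
    (fun _ _ p => heq_of_eq (mapPath_id p)) (fun u h k v x => (pMap_id u h k v x).heq)
  map_comp f g := DoubleFunctor.ext_cell rfl
    (fun _ _ p => heq_of_eq (mapPath_mapPath f.obj f.hor g.obj g.hor p).symm)
    (fun _ _ p => heq_of_eq (mapPath_mapPath f.obj f.ver g.obj g.ver p).symm)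
    (fun u h k v x => (pMap_comp f g u h k v x).heq)

/-- The endofunctor of double signatures: the underlying double signature of the double category
of pinwheel diagrams. -/
abbrev pinwheelEndo : DoubleSig.{u} ⥤ DoubleSig.{u} := pinwheel ⋙ forget

/-! ## Unit and multiplication -/

section unit

variable (S : DoubleSig.{u})

/-- The inclusion of generators: an edge goes to the path of length one on it, and a cell goes to
the string diagram that consists of this cell only. -/
def pinwheelUnit : S ⟶ pinwheelEndo.obj S where
  obj X := X
  hor _ _ e := single (E := S.H) e
  ver _ _ e := single (E := S.V) e
  cell u h k v d := DoubleCat.castCell (pinwheelObj S) (composePath_single (E := S.V) u).symm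
    (composePath_single (E := S.H) h).symm (composePath_single (E := S.H) k).symm
    (composePath_single (E := S.V) v).symm
    (Diagram.gen (G := S.tilt) (DoubleSig.TiltCell.mk u h k v d))

/-- The arrows of the tilted 2-graph of `pinwheelEndo.obj S` are vertical paths and horizontal
paths of `S`; they are sent to the corresponding paths of the tilted 2-graph of `S`. -/
def flattenArr (X Y : S.Obj) :
    (pinwheelEndo.obj S).TiltArr X Y → GPath S.TiltArr X Y
  | .inl p => S.verPath p
  | .inr p => S.horPath p

theorem bindPath_flattenArr_verPath {X Y : S.Obj} (p : GPath (pinwheelEndo.obj S).V X Y) :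
    bindPath (fun X => X) (flattenArr S) ((pinwheelEndo.obj S).verPath p)
      = S.verPath (composePath (pathCat S.V) p) := by
  induction p with
  | nil => rfl
  | cons p e ih =>
    exact (congrArg (fun r => Quiver.Path.comp r (S.verPath e)) ih).trans
      (S.verPath_comp _ _).symm

theorem bindPath_flattenArr_horPath {X Y : S.Obj} (p : GPath (pinwheelEndo.obj S).H X Y) :
    bindPath (fun X => X) (flattenArr S) ((pinwheelEndo.obj S).horPath p)
      = S.horPath (composePath (pathCat S.H) p) := by
  induction p with
  | nil => rfl
  | cons p e ih =>
    exact (congrArg (fun r => Quiver.Path.comp r (S.horPath e)) ih).trans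
      (S.horPath_comp _ _).symm

theorem bindPath_flattenArr_verhor {X Y Z : S.Obj} (p : GPath (pinwheelEndo.obj S).V X Y)
    (q : GPath (pinwheelEndo.obj S).H Y Z) :
    bindPath (fun X => X) (flattenArr S)
        (((pinwheelEndo.obj S).verPath p).comp ((pinwheelEndo.obj S).horPath q))
      = (S.verPath (composePath (pathCat S.V) p)).comp
        (S.horPath (composePath (pathCat S.H) q)) := by
  refine (bindPath_append _ _ _ _).trans ?_
  exact congrArg₂ (fun r s => Quiver.Path.comp r s) (bindPath_flattenArr_verPath S p)
    (bindPath_flattenArr_horPath S q)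

theorem bindPath_flattenArr_horver {X Y Z : S.Obj} (p : GPath (pinwheelEndo.obj S).H X Y)
    (q : GPath (pinwheelEndo.obj S).V Y Z) :
    bindPath (fun X => X) (flattenArr S)
        (((pinwheelEndo.obj S).horPath p).comp ((pinwheelEndo.obj S).verPath q))
      = (S.horPath (composePath (pathCat S.H) p)).comp
        (S.verPath (composePath (pathCat S.V) q)) := by
  refine (bindPath_append _ _ _ _).trans ?_
  exact congrArg₂ (fun r s => Quiver.Path.comp r s) (bindPath_flattenArr_horPath S p)
    (bindPath_flattenArr_verPath S q)

/-- A generating 2-arrow of the tilted 2-graph of `pinwheelEndo.obj S` is itself a string diagram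
on the tilted 2-graph of `S`, and it is sent to that string diagram. -/
def flattenCell : ∀ {X W : S.Obj} (p q : GPath (pinwheelEndo.obj S).TiltArr X W),
    (pinwheelEndo.obj S).TiltCell p q →
    Diagram S.tilt (bindPath (fun X => X) (flattenArr S) p) (bindPath (fun X => X) (flattenArr S) q)
  | _, _, _, _, .mk u h k v d => Diagram.castD (bindPath_flattenArr_verhor S u h).symm
      (bindPath_flattenArr_horver S k v).symm d

/-- The interpretation of string diagrams of string diagrams as string diagrams. -/
def flattenInterp : Interp (pinwheelEndo.obj S).tilt S.tilt where
  obj X := X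
  arr := flattenArr S
  cell p q g := flattenCell S p q g

theorem composePath_flatten {O : Type u} (E : O → O → Type u) {a b : O}
    (p : GPath (GPath (GPath E)) a b) :
    composePath (pathCat E)
        (mapPath (E' := GPath E) (fun X => X) (fun _ _ e => composePath (pathCat E) e) p)
      = composePath (pathCat E) (composePath (pathCat (GPath E)) p) :=
  composePath_mapPath (pathCat (GPath E)) (pathCat E) (fun X => X)
    (fun _ _ e => composePath (pathCat E) e) (fun _ => rfl)
    (fun _ _ _ p q => composePath_append (pathCat E) p q) p

/-- The flattening of string diagrams of string diagrams: a path of paths goes to its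
concatenation, and a string diagram whose generators are string diagrams goes to the string
diagram obtained by substituting them. -/
def pinwheelMult : pinwheelEndo.obj (pinwheelEndo.obj S) ⟶ pinwheelEndo.obj S where
  obj X := X
  hor _ _ p := composePath (pathCat S.H) p
  ver _ _ p := composePath (pathCat S.V) p
  cell u h k v d := DoubleCat.castCell (pinwheelObj S) (composePath_flatten S.V u).symm
    (composePath_flatten S.H h).symm (composePath_flatten S.H k).symm
    (composePath_flatten S.V v).symm
    (Diagram.castD (bindPath_flattenArr_verhor S _ _) (bindPath_flattenArr_horver S _ _)
      ((flattenInterp S).eval d))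

end unit

end PinwheelDouble

/-! On edges, the claim is that paths form a monad under concatenation, used once for the horizontal
and once for the vertical graph. On cells, it is an instance of the universal property of the free
strict 2-category: a 2-functor out of it is determined by its values on generating arrows and
2-arrows.

Concretely, an `Interp` from `G` to `G'` is a Kleisli map for the free strict 2-category
construction, and `eval` is its extension to string diagrams. Two interpretations matter here:
`tiltInterp f` relabels generators along `f`, and `flattenInterp S` opens each generator into the
diagram that labels it. Up to transport of boundaries, the functor acts on cells by evaluation in
the first, the multiplication by evaluation in the second, and the unit forms a generator
(`diagram_map_cell`, `diagram_mult_cell`, `diagram_unit_cell`).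

Naturality of the multiplication, the right unit law and associativity thus become equations between
iterated evaluations. By `eval_eval` an iterated evaluation is a single one in a composite
interpretation, so it suffices to compare these interpretations on edges and on single generators.
There only two rules are needed: relabelling a generator gives the generator on the relabelled cell
(`tiltCell_seq`), and flattening a generator gives its label (`flattenCell_seq`). Naturality of the
unit and the left unit law evaluate one generator only and follow from these rules directly.

What remains is bookkeeping: concatenation is associative and unital only up to provable equality,
so the two sides of a law have boundaries that are written differently. The relation `Diagram.SEq`
absorbs all transports, and it is converted to a heterogeneous equality only at the end, for
`DoubleSig.Hom.ext_cell`. -/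

namespace PinwheelDouble

open TwoGraph

/-! ### Composition of interpretations -/

namespace TwoGraph.Interp

theorem path_path {G G' G'' : TwoGraph.{u}} (I : Interp G G') (J : Interp G' G'') {a b : G.Obj}
    (p : GPath G.Arr a b) : J.path (I.path p)
      = bindPath (fun x => J.obj (I.obj x)) (fun a b e => J.path (I.arr a b e)) p := by
  induction p with
  | nil => rfl
  | cons p e ih =>
    exact (bindPath_append _ _ _ _).trans (congrArg (fun r => Quiver.Path.comp r _) ih)

/-- The composite of two interpretations. -/
def comp {G G' G'' : TwoGraph.{u}} (I : Interp G G') (J : Interp G' G'') : Interp G G'' where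
  obj x := J.obj (I.obj x)
  arr a b e := J.path (I.arr a b e)
  cell p q g := Diagram.castD (path_path I J p) (path_path I J q) (J.eval (I.cell p q g))

theorem comp_cell_seq {G G' G'' : TwoGraph.{u}} (I : Interp G G') (J : Interp G' G'') {a b : G.Obj}
    {p q : GPath G.Arr a b} (g : G.Cell p q) :
    Diagram.SEq ((I.comp J).cell p q g) (J.eval (I.cell p q g)) :=
  Diagram.castD_seq (path_path I J p) (path_path I J q) _

/-- For the composite interpretation, the hypotheses of `eval_eval` hold by construction. The monad
laws use this to collapse one side into a single evaluation; `eval_eval` or `eval_self` then treats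
the other side, with that composite as the interpretation to compare with. -/
theorem eval_comp {G G' G'' : TwoGraph.{u}} (I : Interp G G') (J : Interp G' G'') {a b : G.Obj}
    {p q : GPath G.Arr a b} (x : Diagram G p q) :
    Diagram.SEq ((I.comp J).eval x) (J.eval (I.eval x)) :=
  (eval_eval I J (arr := (I.comp J).arr) (cell := (I.comp J).cell) (fun _ _ _ => rfl)
    (fun _ _ g => (comp_cell_seq I J g).symm) x).symm

end TwoGraph.Interp

/-! ### Concatenation of boundaries and transport along their equalities -/

/-- Relabelling the edges of a path of paths commutes with concatenation. -/
theorem composePath_mapPath_mapPath {O O' : Type u} {E : O → O → Type u} {E' : O' → O' → Type u}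
    (f : O → O') (g : ∀ a b, E a b → E' (f a) (f b)) {a b : O} (p : GPath (GPath E) a b) :
    composePath (pathCat E')
        (mapPath (E' := GPath E') f (fun _ _ e => mapPath f g e) p)
      = mapPath f g (composePath (pathCat E) p) :=
  composePath_mapPath (pathCat E) (pathCat E') f (fun _ _ e => mapPath f g e) (fun _ => rfl)
    (fun _ _ _ p q => mapPath_append f g p q) p

/-- This is the left unit law on edges. It is not definitional: concatenation recurses on its second
argument, so an initial empty path is absorbed only by induction. -/
theorem composePath_single_path {O : Type u} {E : O → O → Type u} {a b : O} (p : GPath E a b) :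
    composePath (pathCat E) (single (E := GPath E) p) = p :=
  Quiver.Path.nil_comp p

/-- Transport of pinwheel diagrams along equalities of boundary paths does not change them. -/
theorem castCell_seq {S : DoubleSig.{u}} {X Y Z W : S.Obj} {u u' : GPath S.V X Y}
    {h h' : GPath S.H Y W} {k k' : GPath S.H X Z} {v v' : GPath S.V Z W} (hu : u = u')
    (hh : h = h') (hk : k = k') (hv : v = v') (x : PCell S u h k v) :
    Diagram.SEq (G := S.tilt) (p' := (S.verPath u).comp (S.horPath h))
      (q' := (S.horPath k).comp (S.verPath v))
      (p := (S.verPath u').comp (S.horPath h')) (q := (S.horPath k').comp (S.verPath v'))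
      (DoubleCat.castCell (pinwheelObj S) hu hh hk hv x) x := by
  subst hu hh hk hv
  exact .refl _

/-! ### Unit, multiplication and functor action as operations on string diagrams -/

section cells

variable {S T R : DoubleSig.{u}}

/-- The string diagram underlying a cell of `pinwheelEndo.obj S`. -/
abbrev diagram {X Y Z W : S.Obj} {u : GPath (pinwheelEndo.obj S).V X Y}
    {h : GPath (pinwheelEndo.obj S).H Y W} {k : GPath (pinwheelEndo.obj S).H X Z}
    {v : GPath (pinwheelEndo.obj S).V Z W} (x : (pinwheelEndo.obj S).Cell u h k v) :
    PCell S (composePath (pathCat S.V) u) (composePath (pathCat S.H) h)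
      (composePath (pathCat S.H) k) (composePath (pathCat S.V) v) := x

/-- No equality between the bounding paths of paths is required: the cell type depends on them only
through their concatenations, and `Diagram.SEq` already compares these. -/
theorem diagram_heq {X Y Z W : S.Obj} {u u' : GPath (pinwheelEndo.obj S).V X Y}
    {h h' : GPath (pinwheelEndo.obj S).H Y W} {k k' : GPath (pinwheelEndo.obj S).H X Z}
    {v v' : GPath (pinwheelEndo.obj S).V Z W} {x : (pinwheelEndo.obj S).Cell u h k v}
    {y : (pinwheelEndo.obj S).Cell u' h' k' v'} (e : Diagram.SEq (diagram x) (diagram y)) :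
    HEq x y := e.heq

/-- Composition in the category of double signatures inserts a transport along `mapPath_mapPath`,
which is invisible to `Diagram.SEq`. Each monad law starts by removing these transports. -/
theorem diagram_comp_cell (f : S ⟶ T) (g : T ⟶ pinwheelEndo.obj R) {X Y Z W : S.Obj}
    (u : GPath S.V X Y) (h : GPath S.H Y W) (k : GPath S.H X Z) (v : GPath S.V Z W)
    (d : S.Cell u h k v) :
    Diagram.SEq (diagram ((f ≫ g).cell u h k v d))
      (diagram (g.cell _ _ _ _ (f.cell u h k v d))) := by
  -- The boundaries in the goal are applications of `mapPath`, where `subst` cannot act;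
  -- generalising them to variables makes the transport trivial.
  have key : ∀ {X Y Z W : R.Obj} {u u' : GPath (pinwheelEndo.obj R).V X Y}
      {h h' : GPath (pinwheelEndo.obj R).H Y W} {k k' : GPath (pinwheelEndo.obj R).H X Z}
      {v v' : GPath (pinwheelEndo.obj R).V Z W} (hu : u = u') (hh : h = h') (hk : k = k')
      (hv : v = v') (x : (pinwheelEndo.obj R).Cell u h k v),
      Diagram.SEq (diagram ((pinwheelEndo.obj R).castCell hu hh hk hv x)) (diagram x) := by
    intro X Y Z W u u' h h' k k' v v' hu hh hk hv x
    subst hu hh hk hv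
    exact .refl _
  exact key (mapPath_mapPath _ _ _ _ u) (mapPath_mapPath _ _ _ _ h) (mapPath_mapPath _ _ _ _ k)
    (mapPath_mapPath _ _ _ _ v) _

theorem diagram_unit_cell {X Y Z W : S.Obj} (u : GPath S.V X Y) (h : GPath S.H Y W)
    (k : GPath S.H X Z) (v : GPath S.V Z W) (d : S.Cell u h k v) :
    Diagram.SEq (diagram ((pinwheelUnit S).cell u h k v d))
      (Diagram.gen (G := S.tilt) (DoubleSig.TiltCell.mk u h k v d)) :=
  castCell_seq (composePath_single (E := S.V) u).symm (composePath_single (E := S.H) h).symm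
    (composePath_single (E := S.H) k).symm (composePath_single (E := S.V) v).symm _

theorem diagram_mult_cell {X Y Z W : S.Obj}
    (u : GPath (pinwheelEndo.obj (pinwheelEndo.obj S)).V X Y)
    (h : GPath (pinwheelEndo.obj (pinwheelEndo.obj S)).H Y W)
    (k : GPath (pinwheelEndo.obj (pinwheelEndo.obj S)).H X Z)
    (v : GPath (pinwheelEndo.obj (pinwheelEndo.obj S)).V Z W)
    (d : (pinwheelEndo.obj (pinwheelEndo.obj S)).Cell u h k v) :
    Diagram.SEq (diagram ((pinwheelMult S).cell u h k v d))
      ((flattenInterp S).eval (diagram d)) :=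
  (castCell_seq (composePath_flatten S.V u).symm (composePath_flatten S.H h).symm
    (composePath_flatten S.H k).symm (composePath_flatten S.V v).symm _).trans
    (Diagram.castD_seq _ _ _)

theorem diagram_map_cell (f : S ⟶ T) {X Y Z W : S.Obj}
    (u : GPath (pinwheelEndo.obj S).V X Y) (h : GPath (pinwheelEndo.obj S).H Y W)
    (k : GPath (pinwheelEndo.obj S).H X Z) (v : GPath (pinwheelEndo.obj S).V Z W)
    (d : (pinwheelEndo.obj S).Cell u h k v) :
    Diagram.SEq (diagram ((pinwheelEndo.map f).cell u h k v d))
      ((tiltInterp f).eval (diagram d)) :=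
  (castCell_seq (composePath_mapPath_mapPath f.obj f.ver u).symm
    (composePath_mapPath_mapPath f.obj f.hor h).symm
    (composePath_mapPath_mapPath f.obj f.hor k).symm
    (composePath_mapPath_mapPath f.obj f.ver v).symm _).trans (pMap_seq f _ _ _ _ _)

/-- Since evaluation of a generator unfolds to the interpretation of its 2-arrow, this is the rule
that a generator labelled by a diagram flattens to that diagram. -/
theorem flattenCell_seq {X Y Z W : S.Obj} (u : GPath (pinwheelEndo.obj S).V X Y)
    (h : GPath (pinwheelEndo.obj S).H Y W) (k : GPath (pinwheelEndo.obj S).H X Z)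
    (v : GPath (pinwheelEndo.obj S).V Z W) (d : (pinwheelEndo.obj S).Cell u h k v) :
    Diagram.SEq (flattenCell S _ _ (DoubleSig.TiltCell.mk u h k v d)) (diagram d) :=
  Diagram.castD_seq (bindPath_flattenArr_verhor S u h).symm
    (bindPath_flattenArr_horver S k v).symm _

end cells

/-! ## The monad laws -/

/-- Both sides send a cell `d` to the generator on its image under `f`. On edges, relabelling a path
of length one computes, so the two sides agree definitionally. -/
theorem pinwheelUnit_naturality {S T : DoubleSig.{u}} (f : S ⟶ T) :
    f ≫ pinwheelUnit T = pinwheelUnit S ≫ pinwheelEndo.map f := by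
  refine DoubleSig.Hom.ext_cell (fun _ _ _ => rfl) (fun _ _ _ => rfl) (fun u h k v d => ?_)
  refine diagram_heq ((diagram_comp_cell f (pinwheelUnit T) u h k v d).trans ?_)
  refine Diagram.SEq.trans ?_ (diagram_comp_cell (pinwheelUnit S) (pinwheelEndo.map f)
    u h k v d).symm
  refine (diagram_unit_cell _ _ _ _ _).trans (Diagram.SEq.trans ?_ (diagram_map_cell f _ _ _ _ _).symm)
  refine Diagram.SEq.trans ?_ (Interp.eval_congr _ (diagram_unit_cell u h k v d)).symm
  exact (tiltCell_seq f u h k v d).symm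

/-- Relabelling inside the labels and then substituting them agrees with substituting first: on a
single generator labelled by `d`, both routes give `d` relabelled along `f`. -/
theorem pinwheelMult_naturality {S T : DoubleSig.{u}} (f : S ⟶ T) :
    pinwheelEndo.map (pinwheelEndo.map f) ≫ pinwheelMult T
      = pinwheelMult S ≫ pinwheelEndo.map f := by
  refine DoubleSig.Hom.ext_cell (fun _ _ p => composePath_mapPath_mapPath f.obj f.hor p)
    (fun _ _ p => composePath_mapPath_mapPath f.obj f.ver p) (fun u h k v d => ?_)
  refine diagram_heq ((diagram_comp_cell (pinwheelEndo.map (pinwheelEndo.map f)) (pinwheelMult T)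
    u h k v d).trans ?_)
  refine Diagram.SEq.trans ?_ (diagram_comp_cell (pinwheelMult S) (pinwheelEndo.map f)
    u h k v d).symm
  refine (diagram_mult_cell _ _ _ _ _).trans
    ((Interp.eval_congr _ (diagram_map_cell (pinwheelEndo.map f) u h k v d)).trans ?_)
  refine Diagram.SEq.trans ?_ (diagram_map_cell f _ _ _ _ _).symm
  refine Diagram.SEq.trans ?_ (Interp.eval_congr _ (diagram_mult_cell u h k v d)).symm
  -- The right-hand side is now one evaluation in the composite of flattening and relabelling, so
  -- the left-hand side need only be compared with it on arrows and generators.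
  refine Diagram.SEq.trans ?_ (Interp.eval_comp (flattenInterp S) (tiltInterp f) (diagram d))
  refine Interp.eval_eval (tiltInterp (pinwheelEndo.map f)) (flattenInterp T)
    (arr := ((flattenInterp S).comp (tiltInterp f)).arr)
    (cell := ((flattenInterp S).comp (tiltInterp f)).cell) ?_ ?_ (diagram d)
  -- An edge of the outer tilted 2-graph is a whole path `p`. The left route turns it into a path of
  -- length one on the relabelled `p` and then flattens, which leaves an initial empty path to
  -- remove.
  · rintro a b (p | p)
    · exact (Quiver.Path.nil_comp _).trans (bindPath_tiltArr_verPath f p).symm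
    · exact (Quiver.Path.nil_comp _).trans (bindPath_tiltArr_horPath f p).symm
  · rintro a b _ _ ⟨u, h, k, v, d⟩
    refine (Interp.eval_congr _ (tiltCell_seq (pinwheelEndo.map f) u h k v d)).trans ?_
    refine (flattenCell_seq _ _ _ _ _).trans ((diagram_map_cell f u h k v d).trans ?_)
    refine Diagram.SEq.trans ?_ (Interp.comp_cell_seq (flattenInterp S) (tiltInterp f) _).symm
    exact (Interp.eval_congr _ (flattenCell_seq u h k v d)).symm

/-- No induction on diagrams is needed: the unit wraps the whole diagram `d` as the label of one
generator, and flattening opens it again. -/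
theorem pinwheel_left_unit (S : DoubleSig.{u}) :
    pinwheelUnit (pinwheelEndo.obj S) ≫ pinwheelMult S = 𝟙 (pinwheelEndo.obj S) := by
  refine DoubleSig.Hom.ext_cell (fun _ _ p => composePath_single_path (E := S.H) p)
    (fun _ _ p => composePath_single_path (E := S.V) p) (fun u h k v d => ?_)
  -- The identity morphism acts on cells by a transport along `mapPath_id`, which is discarded here.
  refine HEq.trans (diagram_heq ?_) (cast_heq _ _).symm
  refine (diagram_comp_cell (pinwheelUnit (pinwheelEndo.obj S)) (pinwheelMult S)
    u h k v d).trans ((diagram_mult_cell _ _ _ _ _).trans ?_)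
  exact (Interp.eval_congr _ (diagram_unit_cell u h k v d)).trans (flattenCell_seq u h k v d)

/-- Here every generator of the diagram is wrapped separately. The composite interpretation fixes
all generators, so by `eval_self` it evaluates each diagram to itself. -/
theorem pinwheel_right_unit (S : DoubleSig.{u}) :
    pinwheelEndo.map (pinwheelUnit S) ≫ pinwheelMult S = 𝟙 (pinwheelEndo.obj S) := by
  refine DoubleSig.Hom.ext_cell (fun _ _ p => composePath_single (E := S.H) p)
    (fun _ _ p => composePath_single (E := S.V) p) (fun u h k v d => ?_)
  refine HEq.trans (diagram_heq ?_) (cast_heq _ _).symm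
  refine (diagram_comp_cell (pinwheelEndo.map (pinwheelUnit S)) (pinwheelMult S)
    u h k v d).trans ((diagram_mult_cell _ _ _ _ _).trans ?_)
  refine (Interp.eval_congr _ (diagram_map_cell (pinwheelUnit S) u h k v d)).trans ?_
  refine (Interp.eval_comp (tiltInterp (pinwheelUnit S)) (flattenInterp S) (diagram d)).symm.trans ?_
  refine Interp.eval_self (G := S.tilt)
    (arr := ((tiltInterp (pinwheelUnit S)).comp (flattenInterp S)).arr)
    (cell := ((tiltInterp (pinwheelUnit S)).comp (flattenInterp S)).cell) ?_ ?_ (diagram d)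
  -- The inner path is the explicit path of length one on `e`, so its concatenation with the empty
  -- path computes.
  · rintro a b (e | e) <;> rfl
  · rintro a b _ _ ⟨u, h, k, v, d⟩
    refine (Interp.comp_cell_seq (tiltInterp (pinwheelUnit S)) (flattenInterp S) _).trans ?_
    refine (Interp.eval_congr _ (tiltCell_seq (pinwheelUnit S) u h k v d)).trans ?_
    exact (flattenCell_seq _ _ _ _ _).trans (diagram_unit_cell u h k v d)

/-- With three layers of diagrams, it suffices to consider one outermost generator, labelled by a
diagram of diagrams `d`. Flattening the label before opening the generator, or opening it and then
flattening, both give the flattening of `d`. -/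
theorem pinwheel_assoc (S : DoubleSig.{u}) :
    pinwheelEndo.map (pinwheelMult S) ≫ pinwheelMult S
      = pinwheelMult (pinwheelEndo.obj S) ≫ pinwheelMult S := by
  refine DoubleSig.Hom.ext_cell (fun _ _ p => composePath_flatten S.H p)
    (fun _ _ p => composePath_flatten S.V p) (fun u h k v d => ?_)
  refine diagram_heq ((diagram_comp_cell (pinwheelEndo.map (pinwheelMult S)) (pinwheelMult S)
    u h k v d).trans ?_)
  refine Diagram.SEq.trans ?_ (diagram_comp_cell (pinwheelMult (pinwheelEndo.obj S))
    (pinwheelMult S) u h k v d).symm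
  refine (diagram_mult_cell _ _ _ _ _).trans
    ((Interp.eval_congr _ (diagram_map_cell (pinwheelMult S) u h k v d)).trans ?_)
  refine Diagram.SEq.trans ?_ (diagram_mult_cell _ _ _ _ _).symm
  refine Diagram.SEq.trans ?_ (Interp.eval_congr _
    (diagram_mult_cell (S := pinwheelEndo.obj S) u h k v d)).symm
  refine Diagram.SEq.trans ?_ (Interp.eval_comp (flattenInterp (pinwheelEndo.obj S))
    (flattenInterp S) (diagram d))
  refine Interp.eval_eval (tiltInterp (pinwheelMult S)) (flattenInterp S)
    (arr := ((flattenInterp (pinwheelEndo.obj S)).comp (flattenInterp S)).arr)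
    (cell := ((flattenInterp (pinwheelEndo.obj S)).comp (flattenInterp S)).cell) ?_ ?_ (diagram d)
  -- Here `p` is a path of paths: one route concatenates it before viewing it in the tilted 2-graph,
  -- the other concatenates the images of its edges there.
  · rintro a b (p | p)
    · exact (Quiver.Path.nil_comp _).trans (bindPath_flattenArr_verPath S p).symm
    · exact (Quiver.Path.nil_comp _).trans (bindPath_flattenArr_horPath S p).symm
  · rintro a b _ _ ⟨u, h, k, v, d⟩
    refine (Interp.eval_congr _ (tiltCell_seq (pinwheelMult S) u h k v d)).trans ?_
    refine (flattenCell_seq _ _ _ _ _).trans ((diagram_mult_cell u h k v d).trans ?_)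
    refine Diagram.SEq.trans ?_ (Interp.comp_cell_seq (flattenInterp (pinwheelEndo.obj S))
      (flattenInterp S) _).symm
    exact (Interp.eval_congr _ (flattenCell_seq (S := pinwheelEndo.obj S) u h k v d)).symm

/-- The pinwheel monad. -/
def pinwheelMonad : CategoryTheory.Monad DoubleSig.{u} where
  toFunctor := pinwheelEndo
  η := { app := pinwheelUnit, naturality := fun _ _ f => pinwheelUnit_naturality f }
  μ := { app := pinwheelMult, naturality := fun _ _ f => pinwheelMult_naturality f }
  assoc := pinwheel_assoc
  left_unit := pinwheel_left_unit
  right_unit := pinwheel_right_unit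

end PinwheelDouble

theorem proposition16 :
    ∃ T : CategoryTheory.Monad PinwheelDouble.DoubleSig.{u},
      T.toFunctor = PinwheelDouble.pinwheel ⋙ PinwheelDouble.forget ∧
      ∀ S : PinwheelDouble.DoubleSig.{u},
        HEq (T.η.app S) (PinwheelDouble.pinwheelUnit S) ∧
        HEq (T.μ.app S) (PinwheelDouble.pinwheelMult S) :=
  -- The components in the statement have types depending on `T.toFunctor`, hence the heterogeneous
  -- equalities; for this witness the functor agrees definitionally, so they are reflexive.
  ⟨PinwheelDouble.pinwheelMonad, rfl, fun _ => ⟨HEq.rfl, HEq.rfl⟩⟩
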